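/- **Theorem 4.** Let $\xi_1,\xi_2,\dots$ be i.i.d. uniform $(0,1)$ random variables with order statistics $\xi_{n1}\le\dots\le\xi_{nn}$. *Kernel (Assumption 1).* Let $k\ge 0$ be a bounded probability density on $\mathbb R$ with mean zero and finite variance whose distribution function $K(x)=\int_{-\infty}^x k$ is differentiable. *Bandwidth (Assumption 2).* Let $b=b_n>0$ with $b_n\to0$ and $nb_n\to\infty$. Put $$F_{n,b}(t)=\frac1{nb}\sum_{i=1}^n\int_{-\infty}^t k\Big(\frac{x-\xi_i}{b}\Big)dx,\qquad F_{n,b}^{-1}(u)=\inf\{t: F_{n,b}(t)\ge u\}.$$ Let $g:(0,1)\to\mathbb R$ be left continuous and of bounded variation on $(\theta,1-\theta)$ for every $\theta\in(0,1/2)$, and let $|g|$ as a measure (as in $d|g|$) denote its total variation measure on $(0,1)$. Let $J:(0,1)\to\mathbb R$ be measurable, let $c_{n1},\dots,c_{nn}$ $(n\ge1)$ be real constants, and let $J_n(t)=c_{ni}$ for $(i-1)/n<t\le i/n$. Fix $M,b_1,b_2,\delta>0$ and put, for $0<t<1$, $$B(t)=Mt^{-b_1}(1-t)^{-b_2},\quad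 D(t)=Mt^{-1+b_1+\delta}(1-t)^{-1+b_2+\delta},\quad h(t)=[t(1-t)]^{1-\delta/2}.$$ *Boundedness (Assumption 3).* $|g|\le D$, $|J_n|\le B$ (for all $n\ge1$) and $|J|\le B$ pointwise on $(0,1)$, and $\int_0^1 Bh\,d|g|<\infty$. *Smoothness (Assumption 4).* For $|g|$-almost every $t$, $J$ is continuous at $t$ and $J_n\to J$ uniformly in some neighbourhood of $t$; moreover $J_n(t)\to J(t)$ for Lebesgue-almost every $t\in(0,1)$ with $g(t)\neq0$ (this is automatic if Lebesgue measure on $(0,1)$ is absolutely continuous with respect to the measure $|g|$). Then $Jg$ is Lebesgue integrable on $(0,1)$, so that $\mu=\int_0^1 J(t)g(t)\,dt$ is finite, and with probability one $$T_n=\int_0^1 g\big(F_{n,b}^{-1}(u)\big)J_n(u)\,du\ \longrightarrow\ \mu\qquad(n\to\infty),$$ where the integrand is read as $0$ at those $u$ for which $F_{n,b}^{-1}(u)\notin(0,1)$, and the integral defining $T_n$ converges absolutely for every $n\ge1$. Likewise, with probability one, the associated linear function of order statistics satisfies $$\frac1n\sum_{i=1}^n g(\xi_{ni})\,c_{ni}\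 \longrightarrow\ \mu .$$ -/

import Mathlib

open MeasureTheory ProbabilityTheory Filter Set
open scoped Topology ENNReal

noncomputable section

namespace KernelLStat

/-! ### Kernel estimator of the distribution function -/

/-- The distribution function `K(x) = ∫_{-∞}^x k` of a kernel density `k`. -/
def kernelCDF (k : ℝ → ℝ) (x : ℝ) : ℝ := ∫ t in Iic x, k t

/-- `k` is a bounded probability density on `ℝ` with mean zero and finite variance, whose
distribution function is differentiable. (Integrability of `x ↦ x * k x` follows from that of `k`
and of `x ↦ x ^ 2 * k x`.) -/
structure IsKernelDensity (k : ℝ → ℝ) : Prop where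
  nonneg : ∀ x, 0 ≤ k x
  bounded : ∃ C : ℝ, ∀ x, k x ≤ C
  integrable : Integrable k
  integral_eq_one : ∫ x, k x = 1
  integrable_sq : Integrable fun x => x ^ 2 * k x
  mean_zero : ∫ x, x * k x = 0
  differentiable_cdf : Differentiable ℝ (kernelCDF k)

/-- The bandwidths `b n > 0` satisfy `b n → 0` and `n * b n → ∞`. -/
structure IsBandwidth (b : ℕ → ℝ) : Prop where
  pos : ∀ n, 1 ≤ n → 0 < b n
  tendsto_zero : Tendsto b atTop (𝓝 0)
  tendsto_mul_atTop : Tendsto (fun n : ℕ => (n : ℝ) * b n) atTop atTop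

/-- The kernel distribution function estimator
`F_{n,b}(t) = (1 / (n b)) ∑_{i=1}^n ∫_{-∞}^t k ((y - x i) / b) dy` of the sample `x`. -/
def kernelEstimator (k : ℝ → ℝ) {n : ℕ} (b : ℝ) (x : Fin n → ℝ) (t : ℝ) : ℝ :=
  1 / (n * b) * ∑ i, ∫ y in Iic t, k ((y - x i) / b)

/-- The left-continuous inverse `F⁻¹(u) = inf {t | u ≤ F t}`. -/
def leftInverse (F : ℝ → ℝ) (u : ℝ) : ℝ := sInf {t | u ≤ F t}

/-! ### Functions on `(0, 1)` that are left continuous and locally of bounded variation -/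

/-- `g` is left continuous on `(0, 1)` and of bounded variation on `(θ, 1 - θ)` for every
`θ ∈ (0, 1/2)`. Only the values of `g` on `(0, 1)` matter. -/
structure IsClassG (g : ℝ → ℝ) : Prop where
  leftCont : ∀ t ∈ Ioo (0 : ℝ) 1, ContinuousWithinAt g (Iic t) t
  bddVar : ∀ θ ∈ Ioo (0 : ℝ) (1 / 2), BoundedVariationOn g (Ioo θ (1 - θ))

theorem IsClassG.locallyBoundedVariationOn {g : ℝ → ℝ} (hg : IsClassG g) :
    LocallyBoundedVariationOn g (Ioo 0 1) := by
  intro a b ha hb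
  have h0 : 0 < min a (1 - b) := lt_min ha.1 (by linarith [hb.2])
  rcases lt_or_ge b a with hab | hab
  · rw [Icc_eq_empty (not_le.2 hab)]
    simp [BoundedVariationOn]
  have h1 : min a (1 - b) ≤ 1 / 2 := by
    rcases le_total a (1 / 2) with h | h
    · exact (min_le_left _ _).trans h
    · exact (min_le_right _ _).trans (by linarith)
  refine (hg.bddVar (min a (1 - b) / 2) ⟨by linarith, by linarith⟩).mono ?_
  rintro t ⟨-, ht⟩
  exact ⟨by linarith [min_le_left a (1 - b), ht.1], by linarith [min_le_right a (1 - b), ht.2]⟩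

/-- The variation of `g` from `1/2` to the point `t = sigmoid x`, where `sigmoid` is the logistic
increasing homeomorphism from `ℝ` onto `(0, 1)`. -/
def variationFun (g : ℝ → ℝ) (x : ℝ) : ℝ :=
  variationOnFromTo g (Ioo 0 1) (1 / 2) (Real.sigmoid x)

theorem IsClassG.monotone_variationFun {g : ℝ → ℝ} (hg : IsClassG g) :
    Monotone (variationFun g) := fun x y hxy =>
  variationOnFromTo.monotoneOn hg.locallyBoundedVariationOn (by norm_num)
    ⟨Real.sigmoid_pos x, Real.sigmoid_lt_one x⟩ ⟨Real.sigmoid_pos y, Real.sigmoid_lt_one y⟩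
    (Real.sigmoid_monotone hxy)

/-- The total variation measure `|g|` on `(0, 1)`: the Lebesgue-Stieltjes measure of the variation
function of `g`. It may be infinite near `0` and `1`, so the Stieltjes measure is built on `ℝ` in
the logistic coordinate and pushed forward to `(0, 1)`. It is the measure concentrated on `(0, 1)`
with `|g| [a, b) = Var (g; [a, b])` for `0 < a ≤ b < 1`, see `variationMeasure_Ico`. -/
def variationMeasure (g : ℝ → ℝ) (hg : IsClassG g) : Measure ℝ :=
  hg.monotone_variationFun.stieltjesFunction.measure.map Real.sigmoid

theorem variationMeasure_compl (g : ℝ → ℝ) (hg : IsClassG g) :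
    variationMeasure g hg (Ioo 0 1)ᶜ = 0 := by
  rw [variationMeasure, Measure.map_apply continuous_sigmoid.measurable measurableSet_Ioo.compl]
  have hpre : Real.sigmoid ⁻¹' (Ioo 0 1)ᶜ = ∅ := by
    ext x
    simp [Real.sigmoid_pos x, Real.sigmoid_lt_one x]
  rw [hpre, measure_empty]

theorem leftLim_variationFun {g : ℝ → ℝ} (hg : IsClassG g) (x : ℝ) :
    Function.leftLim hg.monotone_variationFun.stieltjesFunction x = variationFun g x := by
  have h1 : Function.leftLim hg.monotone_variationFun.stieltjesFunction x
      = Function.leftLim (variationFun g) x :=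
    leftLim_rightLim (hg.monotone_variationFun.tendsto_leftLim x)
  rw [h1]
  have hx : Real.sigmoid x ∈ Ioo (0 : ℝ) 1 := ⟨Real.sigmoid_pos x, Real.sigmoid_lt_one x⟩
  refine leftLim_eq_of_tendsto ?_
  have h2 : Tendsto g (𝓝[Ioo 0 1 ∩ Iio (Real.sigmoid x)] (Real.sigmoid x))
      (𝓝 (g (Real.sigmoid x))) :=
    Tendsto.mono_left (hg.leftCont _ hx) (nhdsWithin_mono _ fun t ht => mem_Iic.2 (le_of_lt ht.2))
  have h3 := variationOnFromTo.tendsto_left (a := 1 / 2) (by norm_num) hx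
    hg.locallyBoundedVariationOn h2
  rw [dist_self, sub_zero] at h3
  refine h3.comp (tendsto_nhdsWithin_iff.2 ⟨?_, ?_⟩)
  · exact continuous_sigmoid.continuousAt.mono_left nhdsWithin_le_nhds
  · filter_upwards [self_mem_nhdsWithin] with y hy
    exact ⟨⟨Real.sigmoid_pos y, Real.sigmoid_lt_one y⟩, Real.sigmoid_lt hy⟩

theorem variationMeasure_Ico (g : ℝ → ℝ) (hg : IsClassG g) {a b : ℝ} (ha : 0 < a) (hab : a ≤ b)
    (hb : b < 1) : variationMeasure g hg (Ico a b) = eVariationOn g (Icc a b) := by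
  have hai : a ∈ Ioo (0 : ℝ) 1 := ⟨ha, hab.trans_lt hb⟩
  have hbi : b ∈ Ioo (0 : ℝ) 1 := ⟨ha.trans_le hab, hb⟩
  obtain ⟨x, rfl⟩ : a ∈ range Real.sigmoid := by rwa [Real.range_sigmoid]
  obtain ⟨y, rfl⟩ : b ∈ range Real.sigmoid := by rwa [Real.range_sigmoid]
  have hpre : Real.sigmoid ⁻¹' Ico (Real.sigmoid x) (Real.sigmoid y) = Ico x y := by
    ext z
    exact and_congr Real.sigmoid_le_iff Real.sigmoid_lt_iff
  rw [variationMeasure, Measure.map_apply continuous_sigmoid.measurable measurableSet_Ico, hpre,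
    StieltjesFunction.measure_Ico, leftLim_variationFun hg, leftLim_variationFun hg,
    variationFun, variationFun, 
    variationOnFromTo.sub_right hg.locallyBoundedVariationOn (by norm_num) hbi hai,
    variationOnFromTo.eq_of_le _ _ hab,
    ENNReal.ofReal_toReal (hg.locallyBoundedVariationOn _ _ hai hbi),
    inter_eq_self_of_subset_right]
  exact fun z hz => ⟨ha.trans_le hz.1, hz.2.trans_lt hb⟩

/-! ### Scores, the statistic and its bounding functions -/

/-- The score function `J_n` of the constants `c n 1, …, c n n`: `J_n(t) = c n i` for
`(i - 1) / n < t ≤ i / n`, and `J_n(0) = c n 1`. -/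
def scoreFun (c : ℕ → ℕ → ℝ) (n : ℕ) (t : ℝ) : ℝ := c n (max 1 ⌈(n : ℝ) * t⌉₊)

/-- The integrand `u ↦ g (F_{n,b}⁻¹(u)) J_n(u)`. The function `g` lives on `(0, 1)`, while
`F_{n,b}⁻¹` may take values outside of it; there the integrand is `0`. -/
def kernelIntegrand (k : ℝ → ℝ) (g : ℝ → ℝ) (c : ℕ → ℕ → ℝ) {n : ℕ} (b : ℝ) (x : Fin n → ℝ)
    (u : ℝ) : ℝ :=
  (Ioo (0 : ℝ) 1).indicator g (leftInverse (kernelEstimator k b x) u) * scoreFun c n u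

/-- The kernel statistic `T_n = ∫_0^1 g (F_{n,b}⁻¹(u)) J_n(u) du`. -/
def kernelStatistic (k : ℝ → ℝ) (g : ℝ → ℝ) (c : ℕ → ℕ → ℝ) {n : ℕ} (b : ℝ) (x : Fin n → ℝ) : ℝ :=
  ∫ u in Ioo (0 : ℝ) 1, kernelIntegrand k g c b x u

/-- The order statistics `x_{n1} ≤ … ≤ x_{nn}` of the sample `x` (indexed from `0`). -/
def orderStat {n : ℕ} (x : Fin n → ℝ) (i : Fin n) : ℝ := x (Tuple.sort x i)

/-- The L-statistic `(1 / n) ∑_{i=1}^n g(x_{ni}) c_{ni}`. -/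
def lStatistic (g : ℝ → ℝ) (c : ℕ → ℕ → ℝ) {n : ℕ} (x : Fin n → ℝ) : ℝ :=
  1 / n * ∑ i : Fin n, g (orderStat x i) * c n (i + 1)

/-- `B(t) = M t^{-b₁} (1 - t)^{-b₂}`. -/
def boundB (M b₁ b₂ t : ℝ) : ℝ := M * t ^ (-b₁) * (1 - t) ^ (-b₂)

/-- `D(t) = M t^{-1 + b₁ + δ} (1 - t)^{-1 + b₂ + δ}`. -/
def boundD (M b₁ b₂ δ t : ℝ) : ℝ := M * t ^ (-1 + b₁ + δ) * (1 - t) ^ (-1 + b₂ + δ)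

/-- `h(t) = [t (1 - t)]^{1 - δ/2}`. -/
def weightH (δ t : ℝ) : ℝ := (t * (1 - t)) ^ (1 - δ / 2)

/-- Boundedness: `|g| ≤ D`, `|J_n| ≤ B` and `|J| ≤ B` on `(0, 1)`, and `∫_0^1 B h d|g| < ∞`. -/
structure BoundednessCondition (g J : ℝ → ℝ) (hg : IsClassG g) (c : ℕ → ℕ → ℝ)
    (M b₁ b₂ δ : ℝ) : Prop where
  abs_g_le : ∀ t ∈ Ioo (0 : ℝ) 1, |g t| ≤ boundD M b₁ b₂ δ t
  abs_score_le : ∀ n, 1 ≤ n → ∀ t ∈ Ioo (0 : ℝ) 1, |scoreFun c n t| ≤ boundB M b₁ b₂ t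
  abs_J_le : ∀ t ∈ Ioo (0 : ℝ) 1, |J t| ≤ boundB M b₁ b₂ t
  lintegral_lt_top :
    ∫⁻ t in Ioo (0 : ℝ) 1, ENNReal.ofReal (boundB M b₁ b₂ t * weightH δ t) ∂variationMeasure g hg < ∞

/-- Smoothness: at `|g|`-almost every `t`, `J` is continuous and `J_n → J` uniformly in some
neighbourhood of `t`; moreover `J_n(t) → J(t)` for Lebesgue-almost every `t ∈ (0, 1)` with
`g t ≠ 0`. The second part does not follow from the first where `|g|` vanishes, e.g. on an interval
of constancy of `g`; it does follow if Lebesgue measure on `(0, 1)` is absolutely continuous with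
respect to `|g|`. -/
structure SmoothnessCondition (g J : ℝ → ℝ) (hg : IsClassG g) (c : ℕ → ℕ → ℝ) : Prop where
  ae_variation : ∀ᵐ t ∂variationMeasure g hg,
    ContinuousAt J t ∧ ∃ U ∈ 𝓝 t, TendstoUniformlyOn (fun n => scoreFun c n) J atTop U
  ae_volume : ∀ᵐ t ∂volume.restrict (Ioo (0 : ℝ) 1),
    g t ≠ 0 → Tendsto (fun n => scoreFun c n t) atTop (𝓝 (J t))

end KernelLStat

end

open KernelLStat

/-!
The quantile transform turns both statistics into integrals over `(0, 1)` of `g (F⁻¹(u)) J_n(u)`,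
where `F` is the distribution function of the empirical measure or of its convolution with the
rescaled kernel. As `F⁻¹(u)` tends to `u` almost surely, these integrands converge to `J g`, and
only uniform integrability is at stake. Chernoff bounds on a grid and Borel–Cantelli give almost
surely `F(t) + 1 / n ≥ t ^ (1 + η) / C` and its mirror image, so that the boundedness condition
dominates the integrand by a multiple of `w ^ γ` at `F⁻¹(u)`, where `w(t) = 1 / (t (1 - t))` and
`γ < 1`. The quantile transform turns a norm of this bound back into the integral of `w ^ γ'`
against the random measure, for some `γ' ∈ (γ, 1)`. This integral stays bounded by the strong law
for the empirical measure, and by a Chernoff bound for the smoothed one.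
-/

noncomputable section

namespace KernelLStat

section UniformIntegrability

variable {α E ι : Type*} [MeasurableSpace α] [NormedAddCommGroup E] {μ : Measure α} {p q C : ℝ≥0∞}

theorem unifIntegrable_of_eLpNorm_le {f : ι → α → E} (hp : p ≠ 0) (hpq : p < q) (hC : C ≠ ∞)
    (hf : ∀ i, AEStronglyMeasurable (f i) μ) (hfC : ∀ i, eLpNorm (f i) q μ ≤ C) :
    UnifIntegrable f p μ := by
  set θ : ℝ := 1 / p.toReal - 1 / q.toReal with hθ_def
  have hθ : 0 < θ := by
    have hp0 : 0 < p.toReal := ENNReal.toReal_pos hp hpq.ne_top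
    rcases eq_or_ne q ∞ with rfl | hq
    · simpa [hθ_def] using hp0
    · exact sub_pos.2 (one_div_lt_one_div_of_lt hp0
        ((ENNReal.toReal_lt_toReal hpq.ne_top hq).2 hpq))
  intro ε hε
  have hlim : Tendsto (fun x : ℝ≥0∞ => C * x ^ θ) (𝓝 0) (𝓝 0) := by
    have h := ENNReal.Tendsto.const_mul
      ((ENNReal.continuous_rpow_const (y := θ)).tendsto 0) (Or.inr hC)
    simpa only [ENNReal.zero_rpow_of_pos hθ, mul_zero] using h
  obtain ⟨η, hη, hηε⟩ := ENNReal.nhds_zero_basis_Iic.mem_iff.1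
    (hlim.eventually_le_const (ENNReal.ofReal_pos.2 hε))
  obtain ⟨δ, hδ, hδη⟩ : ∃ δ : ℝ, 0 < δ ∧ ENNReal.ofReal δ ≤ η := by
    obtain ⟨δ, hδ, hδη⟩ := ENNReal.lt_iff_exists_nnreal_btwn.1 hη
    exact ⟨δ, by exact_mod_cast hδ, by simpa using hδη.le⟩
  refine ⟨δ, hδ, fun i s hs hsδ => ?_⟩
  calc eLpNorm (s.indicator (f i)) p μ
      = eLpNorm (f i) p (μ.restrict s) := eLpNorm_indicator_eq_eLpNorm_restrict hs
    _ ≤ eLpNorm (f i) q (μ.restrict s) * μ.restrict s univ ^ θ :=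
        eLpNorm_le_eLpNorm_mul_rpow_measure_univ hpq.le (hf i).restrict
    _ ≤ C * μ s ^ θ := by
        rw [Measure.restrict_apply_univ]
        gcongr
        exact (eLpNorm_mono_measure _ Measure.restrict_le_self).trans (hfC i)
    _ ≤ ENNReal.ofReal ε := hηε (hsδ.trans hδη)

theorem tendsto_integral_of_eLpNorm_le [NormedSpace ℝ E] [IsFiniteMeasure μ] {f : ℕ → α → E}
    {f₀ : α → E} (hp : 1 < p) (hC : C ≠ ∞) (hf : ∀ᶠ n in atTop, AEStronglyMeasurable (f n) μ)
    (hfC : ∀ᶠ n in atTop, eLpNorm (f n) p μ ≤ C)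
    (hlim : ∀ᵐ a ∂μ, Tendsto (fun n => f n a) atTop (𝓝 (f₀ a))) :
    Tendsto (fun n => ∫ a, f n a ∂μ) atTop (𝓝 (∫ a, f₀ a ∂μ)) := by
  obtain ⟨N, hN⟩ := eventually_atTop.1 (hf.and hfC)
  rw [← tendsto_add_atTop_iff_nat N]
  have hmeas : ∀ n, AEStronglyMeasurable (f (n + N)) μ := fun n => (hN _ (by omega)).1
  have hbound : ∀ n, eLpNorm (f (n + N)) p μ ≤ C := fun n => (hN _ (by omega)).2
  have hlim' : ∀ᵐ a ∂μ, Tendsto (fun n => f (n + N) a) atTop (𝓝 (f₀ a)) :=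
    hlim.mono fun a ha => (tendsto_add_atTop_iff_nat N).2 ha
  have hL1 : ∀ n, MemLp (f (n + N)) 1 μ := fun n =>
    MemLp.mono_exponent ⟨hmeas n, (hbound n).trans_lt hC.lt_top⟩ hp.le
  have hf₀ : MemLp f₀ 1 μ := by
    have hfatou : eLpNorm f₀ p μ ≤ C := (Lp.eLpNorm_lim_le_liminf_eLpNorm hmeas f₀ hlim').trans
      (liminf_le_of_frequently_le' (Frequently.of_forall hbound))
    exact MemLp.mono_exponent ⟨aestronglyMeasurable_of_tendsto_ae atTop hmeas hlim',
      hfatou.trans_lt hC.lt_top⟩ hp.le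
  exact tendsto_integral_of_L1' f₀ hf₀.1
    (Eventually.of_forall fun n => memLp_one_iff_integrable.1 (hL1 n))
    (tendsto_Lp_finite_of_tendsto_ae le_rfl ENNReal.one_ne_top hmeas hf₀
      (unifIntegrable_of_eLpNorm_le one_ne_zero hp hC hmeas hbound) hlim')

end UniformIntegrability

/-- The weight `t ↦ (t (1 - t)) ^ (-γ)` on `(0, 1)`, extended by `0`; for `γ = 1 - δ / 2` it is
`1 / h`. It dominates the integrands of the statistics. -/
def endpointWeight (γ t : ℝ) : ℝ≥0∞ :=
  (Ioo (0 : ℝ) 1).indicator (fun t => ENNReal.ofReal ((t * (1 - t)) ^ (-γ))) t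

section EndpointWeight

variable {γ γ' t : ℝ}

theorem endpointWeight_of_mem (ht : t ∈ Ioo (0 : ℝ) 1) :
    endpointWeight γ t = ENNReal.ofReal ((t * (1 - t)) ^ (-γ)) :=
  indicator_of_mem ht _

@[fun_prop]
theorem measurable_endpointWeight (γ : ℝ) : Measurable (endpointWeight γ) :=
  Measurable.indicator (by fun_prop) measurableSet_Ioo

theorem endpointWeight_ne_top (γ t : ℝ) : endpointWeight γ t ≠ ∞ := by
  by_cases ht : t ∈ Ioo (0 : ℝ) 1 <;> simp [endpointWeight, ht]

theorem endpointWeight_mono_exponent (h : γ ≤ γ') (t : ℝ) :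
    endpointWeight γ t ≤ endpointWeight γ' t := by
  by_cases ht : t ∈ Ioo (0 : ℝ) 1
  · rw [endpointWeight_of_mem ht, endpointWeight_of_mem ht]
    refine ENNReal.ofReal_le_ofReal (Real.rpow_le_rpow_of_exponent_ge ?_ ?_ (neg_le_neg h))
    · exact mul_pos ht.1 (sub_pos.2 ht.2)
    · nlinarith [ht.1, ht.2]
  · simp [endpointWeight, ht]

theorem endpointWeight_rpow {p : ℝ} (hp : 0 < p) (γ t : ℝ) :
    endpointWeight γ t ^ p = endpointWeight (γ * p) t := by
  by_cases ht : t ∈ Ioo (0 : ℝ) 1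
  · have ht0 : 0 ≤ t * (1 - t) := mul_nonneg ht.1.le (sub_nonneg.2 ht.2.le)
    rw [endpointWeight_of_mem ht, endpointWeight_of_mem ht,
      ENNReal.ofReal_rpow_of_nonneg (Real.rpow_nonneg ht0 _) hp.le, ← Real.rpow_mul ht0, neg_mul]
  · simp [endpointWeight, ht, hp]

theorem lintegral_endpointWeight_lt_top (hγ : γ < 1) : ∫⁻ t, endpointWeight γ t < ∞ := by
  have hβ : 0 < beta (1 - γ) (1 - γ) := beta_pos (sub_pos.2 hγ) (sub_pos.2 hγ)
  have hpdf : ∀ t, endpointWeight γ t =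
      ENNReal.ofReal (beta (1 - γ) (1 - γ)) * betaPDF (1 - γ) (1 - γ) t := by
    intro t
    by_cases ht : t ∈ Ioo (0 : ℝ) 1
    · rw [endpointWeight_of_mem ht, betaPDF_of_pos_lt_one ht.1 ht.2, ← ENNReal.ofReal_mul hβ.le,
        Real.mul_rpow ht.1.le (sub_nonneg.2 ht.2.le), mul_assoc, ← mul_assoc,
        mul_one_div_cancel hβ.ne', one_mul, sub_sub_cancel_left]
    · rw [endpointWeight, indicator_of_notMem ht, betaPDF_eq,
        if_neg (show ¬(0 < t ∧ t < 1) from ht), ENNReal.ofReal_zero, mul_zero]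
  simp_rw [hpdf]
  rw [lintegral_const_mul' _ _ ENNReal.ofReal_ne_top,
    lintegral_betaPDF_eq_one (sub_pos.2 hγ) (sub_pos.2 hγ), mul_one]
  exact ENNReal.ofReal_lt_top

end EndpointWeight

/-- The products `g(q) J_n(u)` are dominated by the endpoint weight at `q`, as long as `q` is
related to `u` by a polynomial distortion at both endpoints. The term `1 / n` appears because `J_n`
sees `u` only up to its block. -/
def IsDominated (g : ℝ → ℝ) (c : ℕ → ℕ → ℝ) (η γ : ℝ) : Prop :=
  ∀ C : ℝ, ∃ A : ℝ, ∀ n : ℕ, 1 ≤ n → ∀ u ∈ Ioo (0 : ℝ) 1, ∀ q ∈ Ioo (0 : ℝ) 1,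
    q ^ (1 + η) ≤ C * (u + 1 / n) → (1 - q) ^ (1 + η) ≤ C * (1 - u + 1 / n) →
      ‖g q * scoreFun c n u‖ₑ ≤ ENNReal.ofReal A * endpointWeight γ q

section Domination

variable {g : ℝ → ℝ} {c : ℕ → ℕ → ℝ} {M b₁ b₂ δ : ℝ}

theorem measurable_scoreFun (c : ℕ → ℕ → ℝ) (n : ℕ) : Measurable (scoreFun c n) :=
  (measurable_of_countable fun m : ℕ => c n (max 1 m)).comp
    (Nat.measurable_ceil.comp (measurable_const_mul (n : ℝ)))

-- The midpoint of the block of `u` is at distance at least `1 / (2 n)` from `0` and `1`.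
theorem exists_scoreFun_eq_and_add_inv_le {n : ℕ} (hn : 1 ≤ n) {u : ℝ} (hu : u ∈ Ioo (0 : ℝ) 1) :
    ∃ v ∈ Ioo (0 : ℝ) 1, scoreFun c n v = scoreFun c n u ∧
      u + 1 / n ≤ 4 * v ∧ 1 - u + 1 / n ≤ 4 * (1 - v) := by
  have hn0 : (0 : ℝ) < n := by exact_mod_cast hn
  set m := ⌈(n : ℝ) * u⌉₊ with hm
  have hm1 : 1 ≤ m := Nat.one_le_ceil_iff.2 (mul_pos hn0 hu.1)
  have hmn : m ≤ n := Nat.ceil_le.2 (mul_le_of_le_one_right hn0.le hu.2.le)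
  have hum : n * u ≤ m := Nat.le_ceil _
  have hmu : m < n * u + 1 := Nat.ceil_lt_add_one (mul_pos hn0 hu.1).le
  have hm1' : (1 : ℝ) ≤ m := by exact_mod_cast hm1
  have hmn' : (m : ℝ) ≤ n := by exact_mod_cast hmn
  have hv : n * ((m - 1 / 2) / n : ℝ) = m - 1 / 2 := mul_div_cancel₀ _ hn0.ne'
  have hn1 : n * (1 / n : ℝ) = 1 := mul_one_div_cancel hn0.ne'
  refine ⟨(m - 1 / 2) / n, ⟨by apply div_pos <;> linarith, ?_⟩, ?_, ?_, ?_⟩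
  · rw [div_lt_one hn0]
    linarith
  · have hceil : ⌈(m - 1 / 2 : ℝ)⌉₊ = m := (Nat.ceil_eq_iff (by omega)).2
      ⟨by rw [Nat.cast_sub hm1]; push_cast; linarith, by linarith⟩
    rw [scoreFun, hv, hceil, hm, scoreFun]
  · refine le_of_mul_le_mul_left ?_ hn0
    linarith
  · refine le_of_mul_le_mul_left ?_ hn0
    linarith

theorem rpow_mul_rpow_neg_le {q v b η C : ℝ} (hq : q ∈ Ioo (0 : ℝ) 1) (hv : 0 < v) (hb : 0 ≤ b)
    (hη : η * b ≤ δ / 2) (hqv : q ^ (1 + η) ≤ C * v) :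
    q ^ (-1 + b + δ) * v ^ (-b) ≤ C ^ b * q ^ (-(1 - δ / 2)) := by
  have hqη : 0 < q ^ (1 + η) := Real.rpow_pos_of_pos hq.1 _
  have hC : 0 < C := pos_of_mul_pos_left (hqη.trans_le hqv) hv.le
  have hvb : v ^ (-b) ≤ C ^ b * q ^ ((1 + η) * (-b)) := by
    calc v ^ (-b)
        ≤ (q ^ (1 + η) / C) ^ (-b) :=
          Real.rpow_le_rpow_of_nonpos (div_pos hqη hC) ((div_le_iff₀' hC).2 hqv)
            (neg_nonpos.2 hb)
      _ = C ^ b * q ^ ((1 + η) * (-b)) := by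
          rw [Real.div_rpow hqη.le hC.le, ← Real.rpow_mul hq.1.le, Real.rpow_neg hC.le,
            div_inv_eq_mul, mul_comm]
  calc q ^ (-1 + b + δ) * v ^ (-b)
      ≤ q ^ (-1 + b + δ) * (C ^ b * q ^ ((1 + η) * (-b))) := by
        have := Real.rpow_nonneg hq.1.le (-1 + b + δ)
        gcongr
    _ = C ^ b * q ^ (-1 + b + δ + (1 + η) * (-b)) := by
        rw [Real.rpow_add hq.1 (-1 + b + δ)]
        ring
    _ ≤ C ^ b * q ^ (-(1 - δ / 2)) := by
        refine mul_le_mul_of_nonneg_left ?_ (Real.rpow_nonneg hC.le _)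
        exact Real.rpow_le_rpow_of_exponent_ge hq.1 hq.2.le (by linarith)

theorem boundD_mul_boundB_le {q v η C : ℝ} (hb₁ : 0 ≤ b₁) (hb₂ : 0 ≤ b₂) (hη₁ : η * b₁ ≤ δ / 2)
    (hη₂ : η * b₂ ≤ δ / 2) (hq : q ∈ Ioo (0 : ℝ) 1) (hv : v ∈ Ioo (0 : ℝ) 1)
    (hqv : q ^ (1 + η) ≤ C * v) (hqv' : (1 - q) ^ (1 + η) ≤ C * (1 - v)) :
    boundD M b₁ b₂ δ q * boundB M b₁ b₂ v ≤
      M ^ 2 * C ^ b₁ * C ^ b₂ * (q * (1 - q)) ^ (-(1 - δ / 2)) := by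
  have hq' : 1 - q ∈ Ioo (0 : ℝ) 1 := ⟨sub_pos.2 hq.2, sub_lt_self _ hq.1⟩
  calc boundD M b₁ b₂ δ q * boundB M b₁ b₂ v
      = M ^ 2 * ((q ^ (-1 + b₁ + δ) * v ^ (-b₁)) *
          ((1 - q) ^ (-1 + b₂ + δ) * (1 - v) ^ (-b₂))) := by
        rw [boundD, boundB]
        ring
    _ ≤ M ^ 2 * ((C ^ b₁ * q ^ (-(1 - δ / 2))) * (C ^ b₂ * (1 - q) ^ (-(1 - δ / 2)))) := by
        have hleft := rpow_mul_rpow_neg_le hq hv.1 hb₁ hη₁ hqv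
        have hright := rpow_mul_rpow_neg_le hq' (sub_pos.2 hv.2) hb₂ hη₂ hqv'
        have hright_nonneg : 0 ≤ (1 - q) ^ (-1 + b₂ + δ) * (1 - v) ^ (-b₂) :=
          mul_nonneg (Real.rpow_nonneg hq'.1.le _) (Real.rpow_nonneg (sub_nonneg.2 hv.2.le) _)
        have hleft_nonneg : 0 ≤ q ^ (-1 + b₁ + δ) * v ^ (-b₁) :=
          mul_nonneg (Real.rpow_nonneg hq.1.le _) (Real.rpow_nonneg hv.1.le _)
        exact mul_le_mul_of_nonneg_left
          (mul_le_mul hleft hright hright_nonneg (hleft_nonneg.trans hleft)) (sq_nonneg M)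
    _ = M ^ 2 * C ^ b₁ * C ^ b₂ * (q * (1 - q)) ^ (-(1 - δ / 2)) := by
        rw [Real.mul_rpow hq.1.le hq'.1.le]
        ring

theorem exists_isDominated (hb₁ : 0 ≤ b₁) (hb₂ : 0 ≤ b₂) (hδ : 0 < δ)
    (hg : ∀ t ∈ Ioo (0 : ℝ) 1, |g t| ≤ boundD M b₁ b₂ δ t)
    (hc : ∀ n, 1 ≤ n → ∀ t ∈ Ioo (0 : ℝ) 1, |scoreFun c n t| ≤ boundB M b₁ b₂ t) :
    ∃ η > 0, ∃ γ ∈ Ioo (0 : ℝ) 1, IsDominated g c η γ := by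
  set η : ℝ := δ / (2 * (b₁ + b₂ + 1)) with hη
  have hη_mul : η * (b₁ + b₂ + 1) = δ / 2 := by
    rw [hη]
    field_simp
  have hη0 : 0 < η := by positivity
  have hη₁ : η * b₁ ≤ δ / 2 := by nlinarith [mul_nonneg hη0.le hb₂]
  have hη₂ : η * b₂ ≤ δ / 2 := by nlinarith [mul_nonneg hη0.le hb₁]
  refine ⟨η, hη0, max (1 - δ / 2) (1 / 2), ⟨lt_max_of_lt_right (by norm_num),
    max_lt (by linarith) (by norm_num)⟩, fun C => ⟨M ^ 2 * (4 * C) ^ b₁ * (4 * C) ^ b₂, ?_⟩⟩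
  intro n hn u hu q hq hqu hqu'
  obtain ⟨v, hv, hscore, huv, huv'⟩ := exists_scoreFun_eq_and_add_inv_le (c := c) hn hu
  have hC : 0 < C := pos_of_mul_pos_left ((Real.rpow_pos_of_pos hq.1 _).trans_le hqu)
    (add_nonneg hu.1.le (by positivity))
  have hprod : |g q * scoreFun c n u| ≤
      M ^ 2 * (4 * C) ^ b₁ * (4 * C) ^ b₂ * (q * (1 - q)) ^ (-(1 - δ / 2)) := by
    rw [abs_mul, ← hscore]
    refine (mul_le_mul (hg q hq) (hc n hn v hv) (abs_nonneg _)
      ((abs_nonneg _).trans (hg q hq))).trans ?_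
    exact boundD_mul_boundB_le hb₁ hb₂ hη₁ hη₂ hq hv (by nlinarith) (by nlinarith)
  rw [Real.enorm_eq_ofReal_abs]
  calc ENNReal.ofReal |g q * scoreFun c n u|
      ≤ ENNReal.ofReal (M ^ 2 * (4 * C) ^ b₁ * (4 * C) ^ b₂) * endpointWeight (1 - δ / 2) q := by
        rw [endpointWeight_of_mem hq, ← ENNReal.ofReal_mul (by positivity)]
        exact ENNReal.ofReal_le_ofReal hprod
    _ ≤ _ := by
        gcongr
        exact endpointWeight_mono_exponent (le_max_left _ _) q

end Domination

section Quantile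

variable (ν : Measure ℝ)

theorem leftInverse_cdf_le_iff {u : ℝ} (hu : u ∈ Ioo (0 : ℝ) 1) (t : ℝ) :
    leftInverse (cdf ν) u ≤ t ↔ u ≤ cdf ν t := by
  set S : Set ℝ := {t | u ≤ cdf ν t}
  have hne : S.Nonempty := ((tendsto_cdf_atTop ν).eventually_const_le hu.2).exists
  have hbdd : BddBelow S := by
    obtain ⟨a, ha⟩ := ((tendsto_cdf_atBot ν).eventually_lt_const hu.1).exists
    exact ⟨a, fun t ht => ((monotone_cdf ν).reflect_lt (ha.trans_le ht)).le⟩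
  have hmem : u ≤ cdf ν (sInf S) := by
    refine ge_of_tendsto (((cdf ν).right_continuous (sInf S)).mono_left
      (nhdsWithin_mono _ Ioi_subset_Ici_self)) ?_
    filter_upwards [self_mem_nhdsWithin] with s hs
    obtain ⟨t, ht, hts⟩ := (csInf_lt_iff hbdd hne).1 hs
    exact le_trans ht (monotone_cdf ν hts.le)
  exact ⟨fun h => hmem.trans (monotone_cdf ν h), fun h => csInf_le hbdd h⟩

theorem le_cdf_leftInverse_cdf {u : ℝ} (hu : u ∈ Ioo (0 : ℝ) 1) :
    u ≤ cdf ν (leftInverse (cdf ν) u) :=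
  (leftInverse_cdf_le_iff ν hu _).1 le_rfl

theorem monotoneOn_leftInverse_cdf : MonotoneOn (leftInverse (cdf ν)) (Ioo 0 1) :=
  fun _ hu _ hv huv =>
    (leftInverse_cdf_le_iff ν hu _).2 (huv.trans (le_cdf_leftInverse_cdf ν hv))

theorem aemeasurable_leftInverse_cdf :
    AEMeasurable (leftInverse (cdf ν)) (volume.restrict (Ioo (0 : ℝ) 1)) :=
  aemeasurable_restrict_of_monotoneOn measurableSet_Ioo (monotoneOn_leftInverse_cdf ν)

theorem volume_restrict_Ioo_Iic {t : ℝ} (ht : t ∈ Icc (0 : ℝ) 1) :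
    volume.restrict (Ioo (0 : ℝ) 1) (Iic t) = ENNReal.ofReal t := by
  rw [restrict_Ioo_eq_restrict_Ioc, Measure.restrict_apply measurableSet_Iic, inter_comm,
    Ioc_inter_Iic, min_eq_right ht.2, Real.volume_Ioc, sub_zero]

theorem map_leftInverse_cdf [IsProbabilityMeasure ν] :
    (volume.restrict (Ioo (0 : ℝ) 1)).map (leftInverse (cdf ν)) = ν := by
  refine Measure.ext_of_Iic _ _ fun t => ?_
  have hpre : (leftInverse (cdf ν) ⁻¹' Iic t : Set ℝ) =ᵐ[volume.restrict (Ioo (0 : ℝ) 1)]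
      Iic (cdf ν t) :=
    (ae_restrict_mem measurableSet_Ioo).mono fun u hu => propext (leftInverse_cdf_le_iff ν hu t)
  rw [Measure.map_apply_of_aemeasurable (aemeasurable_leftInverse_cdf ν) measurableSet_Iic,
    measure_congr hpre, volume_restrict_Ioo_Iic ⟨cdf_nonneg ν t, cdf_le_one ν t⟩, ofReal_cdf]

theorem setLIntegral_comp_leftInverse_cdf [IsProbabilityMeasure ν] {f : ℝ → ℝ≥0∞}
    (hf : Measurable f) : ∫⁻ u in Ioo (0 : ℝ) 1, f (leftInverse (cdf ν) u) = ∫⁻ t, f t ∂ν := by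
  conv_rhs => rw [← map_leftInverse_cdf ν]
  exact (lintegral_map' hf.aemeasurable (aemeasurable_leftInverse_cdf ν)).symm

theorem tendsto_leftInverse_cdf {ν : ℕ → Measure ℝ}
    (hcdf : ∀ s : ℚ, (s : ℝ) ∈ Ioo (0 : ℝ) 1 → Tendsto (fun n => cdf (ν n) s) atTop (𝓝 s))
    {u : ℝ} (hu : u ∈ Ioo (0 : ℝ) 1) :
    Tendsto (fun n => leftInverse (cdf (ν n)) u) atTop (𝓝 u) := by
  refine tendsto_order.2 ⟨fun a ha => ?_, fun a ha => ?_⟩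
  · obtain ⟨s, has, hsu⟩ := exists_rat_btwn (max_lt ha hu.1)
    obtain ⟨has, hs0⟩ := max_lt_iff.1 has
    filter_upwards [(hcdf s ⟨hs0, hsu.trans hu.2⟩).eventually_lt_const hsu] with n hn
    exact has.trans (not_le.1 fun hle => hn.not_ge ((leftInverse_cdf_le_iff _ hu _).1 hle))
  · obtain ⟨s, hus, hsa⟩ := exists_rat_btwn (lt_min ha hu.2)
    obtain ⟨hsa, hs1⟩ := lt_min_iff.1 hsa
    filter_upwards [(hcdf s ⟨hu.1.trans hus, hs1⟩).eventually_const_le hus] with n hn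
    exact ((leftInverse_cdf_le_iff _ hu _).2 hn).trans_lt hsa

end Quantile

/-- Polynomial lower bounds, with an error `r`, for the mass that `ν` puts near the endpoints of
`(0, 1)`. They keep the quantiles of `ν` away from `0` and `1`. -/
structure HasPowerTails (ν : Measure ℝ) (η C r : ℝ) : Prop where
  left : ∀ t ∈ Ioo (0 : ℝ) 1, t ^ (1 + η) ≤ C * (cdf ν t + r)
  right : ∀ t ∈ Ioo (0 : ℝ) 1, (1 - t) ^ (1 + η) ≤ C * (1 - cdf ν t + r)

namespace HasPowerTails

variable {ν : Measure ℝ} {η C r u : ℝ}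

theorem leftInverse_cdf_rpow_le (h : HasPowerTails ν η C r) (hC : 0 ≤ C)
    (hu : u ∈ Ioo (0 : ℝ) 1) (hq : leftInverse (cdf ν) u ∈ Ioo (0 : ℝ) 1) :
    leftInverse (cdf ν) u ^ (1 + η) ≤ C * (u + r) := by
  have hlim : Tendsto (fun t : ℝ => t ^ (1 + η)) (𝓝[<] leftInverse (cdf ν) u)
      (𝓝 (leftInverse (cdf ν) u ^ (1 + η))) :=
    (Real.continuousAt_rpow_const _ _ (Or.inl hq.1.ne')).mono_left nhdsWithin_le_nhds
  refine le_of_tendsto hlim ?_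
  filter_upwards [Ioo_mem_nhdsLT hq.1] with t ht
  have hcdf : cdf ν t < u :=
    not_le.1 fun hle => ht.2.not_ge ((leftInverse_cdf_le_iff ν hu t).2 hle)
  refine (h.left t ⟨ht.1, ht.2.trans hq.2⟩).trans ?_
  gcongr

theorem one_sub_leftInverse_cdf_rpow_le (h : HasPowerTails ν η C r) (hC : 0 ≤ C)
    (hu : u ∈ Ioo (0 : ℝ) 1) (hq : leftInverse (cdf ν) u ∈ Ioo (0 : ℝ) 1) :
    (1 - leftInverse (cdf ν) u) ^ (1 + η) ≤ C * (1 - u + r) := by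
  refine (h.right _ hq).trans ?_
  have := le_cdf_leftInverse_cdf ν hu
  gcongr

end HasPowerTails

theorem hasPowerTails_inv_natCast (ν : Measure ℝ) {η : ℝ} (hη : 0 ≤ η) {n : ℕ} (hn : 1 ≤ n) :
    HasPowerTails ν η n (1 / n) := by
  have hn0 : (0 : ℝ) < n := by exact_mod_cast hn
  have hle : ∀ {s a : ℝ}, s ∈ Icc (0 : ℝ) 1 → 0 ≤ a → s ^ (1 + η) ≤ n * (a + 1 / n) := by
    intro s a hs ha
    rw [mul_add, mul_one_div_cancel hn0.ne']
    exact (Real.rpow_le_one hs.1 hs.2 (by linarith)).trans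
      (le_add_of_nonneg_left (mul_nonneg hn0.le ha))
  exact ⟨fun t ht => hle ⟨ht.1.le, ht.2.le⟩ (cdf_nonneg ν t), fun t ht =>
    hle ⟨sub_nonneg.2 ht.2.le, sub_le_self _ ht.1.le⟩ (sub_nonneg.2 (cdf_le_one ν t))⟩

/-- The integrand `u ↦ g (F⁻¹(u)) J_n(u)` for the distribution function `F` of `ν`, read as `0`
where `F⁻¹(u)` is not in `(0, 1)`. For `ν` the empirical measure it is the integrand of the linear
function of order statistics. -/
def quantileIntegrand (g : ℝ → ℝ) (c : ℕ → ℕ → ℝ) (n : ℕ) (ν : Measure ℝ) (u : ℝ) : ℝ :=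
  (Ioo (0 : ℝ) 1).indicator g (leftInverse (cdf ν) u) * scoreFun c n u

section Convergence

variable {g J : ℝ → ℝ} {c : ℕ → ℕ → ℝ} {η γ γ' : ℝ}

theorem aestronglyMeasurable_quantileIntegrand (hg : Measurable ((Ioo (0 : ℝ) 1).indicator g))
    (n : ℕ) (ν : Measure ℝ) :
    AEStronglyMeasurable (quantileIntegrand g c n ν) (volume.restrict (Ioo (0 : ℝ) 1)) :=
  ((hg.comp_aemeasurable (aemeasurable_leftInverse_cdf ν)).mul
    (measurable_scoreFun c n).aemeasurable).aestronglyMeasurable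

theorem IsDominated.exists_enorm_quantileIntegrand_le (hdom : IsDominated g c η γ) {C : ℝ}
    (hC : 0 ≤ C) :
    ∃ A : ℝ, ∀ (n : ℕ) (ν : Measure ℝ), 1 ≤ n → HasPowerTails ν η C (1 / n) →
      ∀ u ∈ Ioo (0 : ℝ) 1, ‖quantileIntegrand g c n ν u‖ₑ ≤
        ENNReal.ofReal A * endpointWeight γ (leftInverse (cdf ν) u) := by
  obtain ⟨A, hA⟩ := hdom C
  refine ⟨A, fun n ν hn hν u hu => ?_⟩
  by_cases hq : leftInverse (cdf ν) u ∈ Ioo (0 : ℝ) 1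
  · rw [quantileIntegrand, indicator_of_mem hq]
    exact hA n hn u hu _ hq (hν.leftInverse_cdf_rpow_le hC hu hq)
      (hν.one_sub_leftInverse_cdf_rpow_le hC hu hq)
  · simp [quantileIntegrand, hq]

theorem integrableOn_quantileIntegrand (hdom : IsDominated g c η γ) (hη : 0 ≤ η)
    (hg : Measurable ((Ioo (0 : ℝ) 1).indicator g)) {n : ℕ} (hn : 1 ≤ n) {ν : Measure ℝ}
    [IsProbabilityMeasure ν] (hν : ∫⁻ t, endpointWeight γ t ∂ν < ∞) :
    IntegrableOn (quantileIntegrand g c n ν) (Ioo (0 : ℝ) 1) := by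
  obtain ⟨A, hA⟩ := hdom.exists_enorm_quantileIntegrand_le (Nat.cast_nonneg n)
  refine ⟨aestronglyMeasurable_quantileIntegrand hg n ν, ?_⟩
  calc ∫⁻ u in Ioo (0 : ℝ) 1, ‖quantileIntegrand g c n ν u‖ₑ
      ≤ ∫⁻ u in Ioo (0 : ℝ) 1,
          ENNReal.ofReal A * endpointWeight γ (leftInverse (cdf ν) u) :=
        setLIntegral_mono' measurableSet_Ioo (hA n ν hn (hasPowerTails_inv_natCast ν hη hn))
    _ = ENNReal.ofReal A * ∫⁻ t, endpointWeight γ t ∂ν := by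
        rw [lintegral_const_mul' _ _ ENNReal.ofReal_ne_top,
          setLIntegral_comp_leftInverse_cdf ν (measurable_endpointWeight γ)]
    _ < ∞ := ENNReal.mul_lt_top ENNReal.ofReal_lt_top hν

theorem integrableOn_mul_of_tendsto_scoreFun (hdom : IsDominated g c η γ) (hη : 0 ≤ η)
    (hγ : γ < 1) (hg : Measurable ((Ioo (0 : ℝ) 1).indicator g))
    (hscore : ∀ᵐ t ∂volume.restrict (Ioo (0 : ℝ) 1),
      g t ≠ 0 → Tendsto (fun n => scoreFun c n t) atTop (𝓝 (J t))) :
    IntegrableOn (fun t => J t * g t) (Ioo (0 : ℝ) 1) := by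
  have hlim : ∀ᵐ t ∂volume.restrict (Ioo (0 : ℝ) 1),
      Tendsto (fun n => g t * scoreFun c n t) atTop (𝓝 (J t * g t)) := by
    filter_upwards [hscore] with t ht
    rcases eq_or_ne (g t) 0 with h0 | h0
    · simp [h0]
    · exact mul_comm (J t) (g t) ▸ (ht h0).const_mul (g t)
  have hmeas : ∀ n, AEStronglyMeasurable (fun t => g t * scoreFun c n t)
      (volume.restrict (Ioo (0 : ℝ) 1)) := fun n =>
    (((aemeasurable_indicator_iff measurableSet_Ioo).1 hg.aemeasurable).mul
      (measurable_scoreFun c n).aemeasurable).aestronglyMeasurable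
  obtain ⟨A, hA⟩ := hdom 1
  have hbound : ∀ᵐ t ∂volume.restrict (Ioo (0 : ℝ) 1),
      ‖J t * g t‖ₑ ≤ ENNReal.ofReal A * endpointWeight γ t := by
    filter_upwards [hlim, ae_restrict_mem measurableSet_Ioo] with t ht htmem
    have ht' : 1 - t ∈ Ioo (0 : ℝ) 1 := ⟨sub_pos.2 htmem.2, sub_lt_self _ htmem.1⟩
    have hself : ∀ {s : ℝ} (n : ℕ), s ∈ Ioo (0 : ℝ) 1 → s ^ (1 + η) ≤ 1 * (s + 1 / n) := by
      intro s n hs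
      calc s ^ (1 + η) ≤ s := Real.rpow_le_self_of_le_one hs.1.le hs.2.le (by linarith)
        _ ≤ 1 * (s + 1 / n) := by
          rw [one_mul]
          exact le_add_of_nonneg_right (by positivity)
    refine le_of_tendsto ht.enorm ?_
    filter_upwards [eventually_ge_atTop 1] with n hn
    exact hA n hn t htmem t htmem (hself n htmem) (hself n ht')
  refine ⟨aestronglyMeasurable_of_tendsto_ae atTop hmeas hlim, ?_⟩
  calc ∫⁻ t in Ioo (0 : ℝ) 1, ‖J t * g t‖ₑ
      ≤ ∫⁻ t in Ioo (0 : ℝ) 1, ENNReal.ofReal A * endpointWeight γ t := lintegral_mono_ae hbound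
    _ ≤ ENNReal.ofReal A * ∫⁻ t, endpointWeight γ t := by
        rw [lintegral_const_mul' _ _ ENNReal.ofReal_ne_top]
        gcongr
        exact Measure.restrict_le_self
    _ < ∞ := ENNReal.mul_lt_top ENNReal.ofReal_lt_top (lintegral_endpointWeight_lt_top hγ)

theorem tendsto_quantileIntegrand {ν : ℕ → Measure ℝ} {u : ℝ} (hu : u ∈ Ioo (0 : ℝ) 1)
    (hq : Tendsto (fun n => leftInverse (cdf (ν n)) u) atTop (𝓝 u)) (hg : ContinuousAt g u)
    (hbdd : ∃ B, ∀ n, 1 ≤ n → |scoreFun c n u| ≤ B)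
    (hscore : g u ≠ 0 → Tendsto (fun n => scoreFun c n u) atTop (𝓝 (J u))) :
    Tendsto (fun n => quantileIntegrand g c n (ν n) u) atTop (𝓝 (J u * g u)) := by
  have hgq : Tendsto (fun n => (Ioo (0 : ℝ) 1).indicator g (leftInverse (cdf (ν n)) u)) atTop
      (𝓝 (g u)) := by
    refine (hg.tendsto.comp hq).congr' ?_
    filter_upwards [hq.eventually (Ioo_mem_nhds hu.1 hu.2)] with n hn
    exact (Set.indicator_of_mem (s := Ioo (0 : ℝ) 1) hn g).symm
  rcases eq_or_ne (g u) 0 with h0 | h0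
  · obtain ⟨B, hB⟩ := hbdd
    rw [h0, mul_zero]
    rw [h0] at hgq
    refine hgq.zero_mul_isBoundedUnder_le (isBoundedUnder_of_eventually_le (a := B) ?_)
    exact (eventually_ge_atTop 1).mono hB
  · exact mul_comm (J u) (g u) ▸ hgq.mul (hscore h0)

theorem tendsto_integral_quantileIntegrand (hdom : IsDominated g c η γ) (hγ : 0 < γ)
    (hγγ' : γ < γ') (hg : Measurable ((Ioo (0 : ℝ) 1).indicator g))
    (hg_cont : ∀ᵐ t ∂volume.restrict (Ioo (0 : ℝ) 1), ContinuousAt g t)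
    (hbdd : ∀ t ∈ Ioo (0 : ℝ) 1, ∃ B, ∀ n, 1 ≤ n → |scoreFun c n t| ≤ B)
    (hscore : ∀ᵐ t ∂volume.restrict (Ioo (0 : ℝ) 1),
      g t ≠ 0 → Tendsto (fun n => scoreFun c n t) atTop (𝓝 (J t)))
    {ν : ℕ → Measure ℝ} (hν : ∀ᶠ n in atTop, IsProbabilityMeasure (ν n))
    (hcdf : ∀ s : ℚ, (s : ℝ) ∈ Ioo (0 : ℝ) 1 → Tendsto (fun n => cdf (ν n) s) atTop (𝓝 s))
    {C : ℝ} (hC : 0 ≤ C) (htails : ∀ᶠ n : ℕ in atTop, HasPowerTails (ν n) η C (1 / n))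
    {D : ℝ≥0∞} (hD : D ≠ ∞) (hweight : ∀ᶠ n in atTop, ∫⁻ t, endpointWeight γ' t ∂ν n ≤ D) :
    Tendsto (fun n => ∫ u in Ioo (0 : ℝ) 1, quantileIntegrand g c n (ν n) u) atTop
      (𝓝 (∫ t in Ioo (0 : ℝ) 1, J t * g t)) := by
  obtain ⟨A, hA⟩ := hdom.exists_enorm_quantileIntegrand_le hC
  have hp : 1 < γ' / γ := (one_lt_div hγ).2 hγγ'
  have hp0 : 0 < γ' / γ := one_pos.trans hp
  refine tendsto_integral_of_eLpNorm_le (p := ENNReal.ofReal (γ' / γ))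
    (C := (ENNReal.ofReal A ^ (γ' / γ) * D) ^ (1 / (γ' / γ))) (by simpa using hp) ?_
    (Eventually.of_forall fun n => aestronglyMeasurable_quantileIntegrand hg n (ν n)) ?_ ?_
  · exact ENNReal.rpow_ne_top_of_nonneg (by positivity)
      (ENNReal.mul_ne_top (ENNReal.rpow_ne_top_of_nonneg hp0.le ENNReal.ofReal_ne_top) hD)
  · filter_upwards [hν, htails, hweight, eventually_ge_atTop 1] with n hn htail hweight hn1
    rw [eLpNorm_eq_lintegral_rpow_enorm_toReal (by simpa using hp0) ENNReal.ofReal_ne_top,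
      ENNReal.toReal_ofReal hp0.le]
    gcongr
    calc ∫⁻ u in Ioo (0 : ℝ) 1, ‖quantileIntegrand g c n (ν n) u‖ₑ ^ (γ' / γ)
        ≤ ∫⁻ u in Ioo (0 : ℝ) 1, ENNReal.ofReal A ^ (γ' / γ) *
            endpointWeight γ' (leftInverse (cdf (ν n)) u) := by
          refine setLIntegral_mono' measurableSet_Ioo fun u hu => ?_
          rw [← mul_div_cancel₀ γ' hγ.ne', ← endpointWeight_rpow hp0, mul_div_cancel₀ γ' hγ.ne',
            ← ENNReal.mul_rpow_of_nonneg _ _ hp0.le]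
          gcongr
          exact hA n (ν n) hn1 htail u hu
      _ = ENNReal.ofReal A ^ (γ' / γ) * ∫⁻ t, endpointWeight γ' t ∂ν n := by
          rw [lintegral_const_mul' _ _
              (ENNReal.rpow_ne_top_of_nonneg hp0.le ENNReal.ofReal_ne_top),
            setLIntegral_comp_leftInverse_cdf (ν n) (measurable_endpointWeight γ')]
      _ ≤ ENNReal.ofReal A ^ (γ' / γ) * D := by gcongr
  · filter_upwards [hg_cont, hscore, ae_restrict_mem measurableSet_Ioo] with u hgu hscoreu hu
    exact tendsto_quantileIntegrand hu (tendsto_leftInverse_cdf hcdf hu) hgu (hbdd u hu) hscoreu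

end Convergence

section Chernoff

variable {Ω ι : Type*} [MeasurableSpace Ω] {P : Measure Ω} [IsProbabilityMeasure P]

theorem mgf_le_exp_of_mem_Icc {X : Ω → ℝ} (hX : AEMeasurable X P)
    (hX01 : ∀ᵐ ω ∂P, X ω ∈ Icc (0 : ℝ) 1) (t : ℝ) :
    mgf X P t ≤ Real.exp ((Real.exp t - 1) * ∫ ω, X ω ∂P) := by
  have hint : Integrable X P := Integrable.of_mem_Icc 0 1 hX hX01
  have hchord : ∀ᵐ ω ∂P, Real.exp (t * X ω) ≤ 1 + (Real.exp t - 1) * X ω := by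
    filter_upwards [hX01] with ω hω
    have h := convexOn_exp.2 (mem_univ 0) (mem_univ t) (sub_nonneg.2 hω.2) hω.1
      (sub_add_cancel 1 (X ω))
    simp only [smul_eq_mul, mul_zero, zero_add, Real.exp_zero, mul_one] at h
    rw [mul_comm t]
    linarith
  calc mgf X P t ≤ ∫ ω, (1 + (Real.exp t - 1) * X ω) ∂P :=
        integral_mono_ae (integrable_exp_mul_of_mem_Icc hX hX01)
          ((integrable_const 1).add (hint.const_mul _)) hchord
    _ = (Real.exp t - 1) * (∫ ω, X ω ∂P) + 1 := by
        rw [integral_add (integrable_const 1) (hint.const_mul _), integral_const_mul,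
          integral_const, probReal_univ, one_smul, add_comm]
    _ ≤ Real.exp ((Real.exp t - 1) * ∫ ω, X ω ∂P) := Real.add_one_le_exp _

variable {Y : ι → Ω → ℝ}

theorem mgf_sum_le_exp_of_mem_Icc (hY : ∀ i, Measurable (Y i)) (hindep : iIndepFun Y P)
    (hY01 : ∀ i, ∀ᵐ ω ∂P, Y i ω ∈ Icc (0 : ℝ) 1) (s : Finset ι) (t : ℝ) :
    mgf (∑ i ∈ s, Y i) P t ≤ Real.exp ((Real.exp t - 1) * ∑ i ∈ s, ∫ ω, Y i ω ∂P) := by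
  rw [hindep.mgf_sum hY, Finset.mul_sum, Real.exp_sum]
  exact Finset.prod_le_prod (fun _ _ => mgf_nonneg) fun i _ =>
    mgf_le_exp_of_mem_Icc (hY i).aemeasurable (hY01 i) t

theorem measureReal_three_mul_le_sum_le (hY : ∀ i, Measurable (Y i)) (hindep : iIndepFun Y P)
    (hY01 : ∀ i, ∀ᵐ ω ∂P, Y i ω ∈ Icc (0 : ℝ) 1) (s : Finset ι) {m : ℝ} (hm : 0 ≤ m)
    (hsum : ∑ i ∈ s, ∫ ω, Y i ω ∂P ≤ m) :
    P.real {ω | 3 * m ≤ ∑ i ∈ s, Y i ω} ≤ Real.exp (-m) := by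
  have hint := hindep.integrable_exp_mul_sum (t := 1) (s := s) hY fun i _ =>
    integrable_exp_mul_of_mem_Icc (hY i).aemeasurable (hY01 i)
  have hmarkov := measure_ge_le_exp_mul_mgf (3 * m) zero_le_one hint
  simp only [Finset.sum_apply] at hmarkov
  have hexp : Real.exp 1 - 1 ≤ 2 := by linarith [Real.exp_one_lt_d9]
  calc P.real {ω | 3 * m ≤ ∑ i ∈ s, Y i ω}
      ≤ Real.exp (-1 * (3 * m)) * Real.exp ((Real.exp 1 - 1) * ∑ i ∈ s, ∫ ω, Y i ω ∂P) :=
        hmarkov.trans (mul_le_mul_of_nonneg_left (mgf_sum_le_exp_of_mem_Icc hY hindep hY01 s 1)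
          (Real.exp_pos _).le)
    _ ≤ Real.exp (-m) := by
        rw [← Real.exp_add, Real.exp_le_exp]
        have hle : (Real.exp 1 - 1) * ∑ i ∈ s, ∫ ω, Y i ω ∂P ≤ 2 * m :=
          (mul_le_mul_of_nonneg_left hsum (sub_nonneg.2 (Real.one_le_exp zero_le_one))).trans
            (mul_le_mul_of_nonneg_right hexp hm)
        linarith

theorem measureReal_sum_le_half_le (hY : ∀ i, Measurable (Y i)) (hindep : iIndepFun Y P)
    (hY01 : ∀ i, ∀ᵐ ω ∂P, Y i ω ∈ Icc (0 : ℝ) 1) (s : Finset ι) {m : ℝ} (hm : 0 ≤ m)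
    (hsum : m ≤ ∑ i ∈ s, ∫ ω, Y i ω ∂P) :
    P.real {ω | ∑ i ∈ s, Y i ω ≤ m / 2} ≤ Real.exp (-(m / 10)) := by
  have hint := hindep.integrable_exp_mul_sum (t := -1) (s := s) hY fun i _ =>
    integrable_exp_mul_of_mem_Icc (hY i).aemeasurable (hY01 i)
  have hmarkov := measure_le_le_exp_mul_mgf (m / 2) (by norm_num : (-1 : ℝ) ≤ 0) hint
  simp only [Finset.sum_apply] at hmarkov
  have hexp : Real.exp (-1) - 1 ≤ -(3 / 5) := by linarith [Real.exp_neg_one_lt_d9]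
  calc P.real {ω | ∑ i ∈ s, Y i ω ≤ m / 2}
      ≤ Real.exp (- -1 * (m / 2)) *
          Real.exp ((Real.exp (-1) - 1) * ∑ i ∈ s, ∫ ω, Y i ω ∂P) :=
        hmarkov.trans (mul_le_mul_of_nonneg_left
          (mgf_sum_le_exp_of_mem_Icc hY hindep hY01 s (-1)) (Real.exp_pos _).le)
    _ ≤ Real.exp (-(m / 10)) := by
        rw [← Real.exp_add, Real.exp_le_exp]
        have hle : (Real.exp (-1) - 1) * ∑ i ∈ s, ∫ ω, Y i ω ∂P ≤ -(3 / 5) * m :=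
          (mul_le_mul_of_nonneg_right hexp (hm.trans hsum)).trans
            (mul_le_mul_of_nonpos_left hsum (by norm_num))
        linarith

end Chernoff

section BorelCantelli

variable {Ω : Type*} [MeasurableSpace Ω] {P : Measure Ω}

theorem ae_eventually_notMem_of_measureReal_le [IsFiniteMeasure P] {s : ℕ → Set Ω} {f : ℕ → ℝ}
    (hf : Summable f) (h : ∀ᶠ n in atTop, P.real (s n) ≤ f n) :
    ∀ᵐ ω ∂P, ∀ᶠ n in atTop, ω ∉ s n := by
  have hsum : Summable fun n => P.real (s n) := by
    refine summable_of_isBigO_nat hf (Asymptotics.IsBigO.of_bound 1 ?_)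
    filter_upwards [h] with n hn
    rw [one_mul, Real.norm_of_nonneg measureReal_nonneg]
    exact hn.trans (le_abs_self _)
  refine ae_eventually_notMem ?_
  simp_rw [← fun n => ofReal_measureReal (μ := P) (s := s n)]
  exact hsum.tsum_ofReal_ne_top

theorem summable_mul_exp_neg_mul_rpow {a ρ : ℝ} (ha : 0 < a) (hρ : 0 < ρ) :
    Summable fun n : ℕ => (n : ℝ) * Real.exp (-a * (n : ℝ) ^ ρ) := by
  have hpow : Tendsto (fun n : ℕ => (n : ℝ) ^ ρ) atTop atTop :=
    (tendsto_rpow_atTop hρ).comp tendsto_natCast_atTop_atTop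
  have hexp := (isLittleO_exp_neg_mul_rpow_atTop ha (-3 / ρ)).comp_tendsto hpow
  refine summable_of_isBigO_nat (g := fun n : ℕ => (n : ℝ) ^ (-2 : ℝ))
    (Real.summable_nat_rpow.2 (by norm_num)) ?_
  refine ((Asymptotics.isBigO_refl (fun n : ℕ => (n : ℝ)) atTop).mul hexp.isBigO).congr'
    EventuallyEq.rfl ?_
  filter_upwards [eventually_gt_atTop 0] with n hn
  have hn0 : (0 : ℝ) < n := by exact_mod_cast hn
  rw [Function.comp_apply, ← Real.rpow_mul hn0.le, mul_div_cancel₀ _ hρ.ne',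
    ← Real.rpow_one_add' hn0.le (by norm_num)]
  norm_num

variable [IsProbabilityMeasure P]

theorem ae_eventually_sum_le_of_le_rpow {Y : ℕ → ℕ → Ω → ℝ} (hY : ∀ n i, Measurable (Y n i))
    (hindep : ∀ n, iIndepFun (Y n) P) {L θ A : ℝ} (hL : 0 < L) (hθ : θ < 1) (hA : 0 < A)
    (hYL : ∀ᶠ n : ℕ in atTop, ∀ i, ∀ᵐ ω ∂P, Y n i ω ∈ Icc 0 (L * (n : ℝ) ^ θ))
    (hYA : ∀ᶠ n in atTop, ∀ i, ∫ ω, Y n i ω ∂P ≤ A) :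
    ∀ᵐ ω ∂P, ∀ᶠ n : ℕ in atTop, ∑ i ∈ Finset.range n, Y n i ω ≤ 3 * (n * A) := by
  have htail : ∀ᶠ n : ℕ in atTop, P.real {ω | 3 * (n * A) ≤ ∑ i ∈ Finset.range n, Y n i ω} ≤
      n * Real.exp (-(A / L) * (n : ℝ) ^ (1 - θ)) := by
    filter_upwards [hYL, hYA, eventually_ge_atTop 1] with n hnL hnA hn
    have hn0 : (0 : ℝ) < n := by exact_mod_cast hn
    set R : ℝ := L * (n : ℝ) ^ θ with hR
    have hR0 : 0 < R := by positivity
    have hchernoff := measureReal_three_mul_le_sum_le (P := P) (Y := fun i ω => Y n i ω / R)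
      (m := n * A / R) (fun i => (hY n i).div_const R)
      ((hindep n).comp (fun _ y => y / R) fun _ => measurable_id.div_const R)
      (fun i => (hnL i).mono fun ω hω => ⟨div_nonneg hω.1 hR0.le, (div_le_one hR0).2 hω.2⟩)
      (Finset.range n) (by positivity) (by
        simp only [integral_div, ← Finset.sum_div]
        gcongr
        simpa using Finset.sum_le_card_nsmul (Finset.range n) _ A fun i _ => hnA i)
    have hexp : -(n * A / R) = -(A / L) * (n : ℝ) ^ (1 - θ) := by
      rw [hR, Real.rpow_sub hn0, Real.rpow_one]
      field_simp
    simp only [← Finset.sum_div, ← mul_div_assoc, div_le_div_iff_of_pos_right hR0, hexp]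
      at hchernoff
    exact hchernoff.trans (le_mul_of_one_le_left (Real.exp_pos _).le (by exact_mod_cast hn))
  filter_upwards [ae_eventually_notMem_of_measureReal_le
    (summable_mul_exp_neg_mul_rpow (div_pos hA hL) (sub_pos.2 hθ)) htail] with ω hω
  exact hω.mono fun n hn => (not_le.1 hn).le

end BorelCantelli

section Empirical

variable {E F : Type*} [MeasurableSpace E] [MeasurableSpace F]

/-- The empirical measure of a sample `x`, with mass `1 / n` at each sample point. -/
def empiricalMeasure {n : ℕ} (x : Fin n → E) : Measure E :=
  (n : ℝ≥0∞)⁻¹ • ∑ i, Measure.dirac (x i)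

theorem lintegral_empiricalMeasure {n : ℕ} (x : Fin n → E) {f : E → ℝ≥0∞} (hf : Measurable f) :
    ∫⁻ y, f y ∂empiricalMeasure x = (n : ℝ≥0∞)⁻¹ * ∑ i, f (x i) := by
  simp only [empiricalMeasure, lintegral_smul_measure, lintegral_finsetSum_measure,
    lintegral_dirac' _ hf, smul_eq_mul]

theorem map_empiricalMeasure {n : ℕ} (x : Fin n → E) {f : E → F} (hf : Measurable f) :
    (empiricalMeasure x).map f = empiricalMeasure (f ∘ x) := by
  refine Measure.ext_of_lintegral _ fun φ hφ => ?_
  rw [lintegral_map hφ hf, lintegral_empiricalMeasure x (f := fun y => φ (f y)) (hφ.comp hf),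
    lintegral_empiricalMeasure _ hφ]
  rfl

theorem isProbabilityMeasure_empiricalMeasure {n : ℕ} (hn : 1 ≤ n) (x : Fin n → E) :
    IsProbabilityMeasure (empiricalMeasure x) := by
  have hn0 : (n : ℝ≥0∞) ≠ 0 := by exact_mod_cast (by omega : n ≠ 0)
  refine ⟨?_⟩
  rw [← lintegral_one, lintegral_empiricalMeasure x measurable_const]
  simp [ENNReal.inv_mul_cancel hn0 (ENNReal.natCast_ne_top n)]

theorem empiricalMeasure_real_apply {n : ℕ} (x : Fin n → E) {S : Set E} (hS : MeasurableSet S) :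
    (empiricalMeasure x).real S = (∑ i, S.indicator 1 (x i)) / n := by
  have hreal : ∀ y, (S.indicator 1 y : ℝ≥0∞).toReal = S.indicator 1 y := fun y => by
    by_cases hy : y ∈ S <;> simp [hy]
  rw [measureReal_def, ← lintegral_indicator_one hS,
    lintegral_empiricalMeasure x (measurable_one.indicator hS), ENNReal.toReal_mul,
    ENNReal.toReal_sum fun i _ => by by_cases hi : x i ∈ S <;> simp [hi]]
  simp only [hreal, ENNReal.toReal_inv, ENNReal.toReal_natCast]
  rw [inv_mul_eq_div]

theorem lintegral_empiricalMeasure_ofReal {n : ℕ} (x : Fin n → E) {f : E → ℝ} (hf : Measurable f)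
    (hf0 : 0 ≤ f) :
    ∫⁻ y, ENNReal.ofReal (f y) ∂empiricalMeasure x = ENNReal.ofReal ((∑ i, f (x i)) / n) := by
  rcases n.eq_zero_or_pos with rfl | hn
  · simp [empiricalMeasure]
  · rw [lintegral_empiricalMeasure x hf.ennreal_ofReal, div_eq_inv_mul,
      ENNReal.ofReal_mul (by positivity), ENNReal.ofReal_inv_of_pos (by exact_mod_cast hn),
      ENNReal.ofReal_natCast, ENNReal.ofReal_sum_of_nonneg fun i _ => hf0 (x i)]

variable {Ω : Type*} [MeasurableSpace Ω] {P : Measure Ω} {μ : Measure E} {ξ : ℕ → Ω → E}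

theorem ae_tendsto_lintegral_empiricalMeasure (hindep : iIndepFun ξ P)
    (hlaw : ∀ i, HasLaw (ξ i) μ P) {f : E → ℝ≥0∞} (hf : Measurable f) (hf_top : ∀ y, f y ≠ ∞)
    (hfμ : ∫⁻ y, f y ∂μ ≠ ∞) :
    ∀ᵐ ω ∂P, Tendsto (fun n => ∫⁻ y, f y ∂empiricalMeasure fun i : Fin n => ξ i ω) atTop
      (𝓝 (∫⁻ y, f y ∂μ)) := by
  have hint : Integrable (fun y => (f y).toReal) μ := integrable_toReal_of_lintegral_ne_top
    hf.aemeasurable hfμ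
  have hlim := strong_law_ae_real (fun i ω => (f (ξ i ω)).toReal)
    ((hlaw 0).map_eq ▸ hint |>.comp_aemeasurable (hlaw 0).aemeasurable)
    (fun i j hij => (hindep.indepFun hij).comp hf.ennreal_toReal hf.ennreal_toReal)
    (fun i => ((hlaw i).identDistrib (hlaw 0)).comp hf.ennreal_toReal)
  filter_upwards [hlim] with ω hω
  have hmean : ∫⁻ y, f y ∂μ = ENNReal.ofReal (∫ ω, (f (ξ 0 ω)).toReal ∂P) := by
    rw [show ∫ ω, (f (ξ 0 ω)).toReal ∂P = ∫ y, (f y).toReal ∂μ from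
        (hlaw 0).integral_comp hint.aestronglyMeasurable,
      integral_toReal hf.aemeasurable (ae_of_all _ fun y => (hf_top y).lt_top),
      ENNReal.ofReal_toReal hfμ]
  rw [hmean]
  refine (ENNReal.tendsto_ofReal hω).congr fun n => ?_
  rw [Finset.sum_range, ← lintegral_empiricalMeasure_ofReal (fun i : Fin n => ξ i ω)
    hf.ennreal_toReal fun _ => ENNReal.toReal_nonneg]
  simp only [ENNReal.ofReal_toReal (hf_top _)]

theorem ae_tendsto_empiricalMeasure_real [IsFiniteMeasure μ] (hindep : iIndepFun ξ P)
    (hlaw : ∀ i, HasLaw (ξ i) μ P) {S : Set E} (hS : MeasurableSet S) :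
    ∀ᵐ ω ∂P, Tendsto (fun n => (empiricalMeasure fun i : Fin n => ξ i ω).real S) atTop
      (𝓝 (μ.real S)) := by
  filter_upwards [ae_tendsto_lintegral_empiricalMeasure hindep hlaw
    (f := S.indicator 1) (measurable_one.indicator hS)
    (fun y => by by_cases hy : y ∈ S <;> simp [hy])
    (by rw [lintegral_indicator_one hS]; exact measure_ne_top μ S)] with ω hω
  simp only [lintegral_indicator_one hS] at hω
  exact (ENNReal.tendsto_toReal (measure_ne_top μ S)).comp hω

variable [IsProbabilityMeasure P]

theorem ae_eventually_lintegral_empiricalMeasure_le (hξ : ∀ i, Measurable (ξ i))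
    (hindep : iIndepFun ξ P) (hlaw : ∀ i, HasLaw (ξ i) μ P) {w : ℕ → E → ℝ≥0∞}
    (hw : ∀ n, Measurable (w n)) {L θ A : ℝ} (hL : 0 < L) (hθ : θ < 1) (hA : 0 < A)
    (hwL : ∀ᶠ n : ℕ in atTop, ∀ y, w n y ≤ ENNReal.ofReal (L * (n : ℝ) ^ θ))
    (hwA : ∀ᶠ n in atTop, ∫⁻ y, w n y ∂μ ≤ ENNReal.ofReal A) :
    ∀ᵐ ω ∂P, ∀ᶠ n in atTop,
      ∫⁻ y, w n y ∂(empiricalMeasure fun i : Fin n => ξ i ω) ≤ ENNReal.ofReal (3 * A) := by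
  have hmean : ∀ᶠ n in atTop, ∀ i, ∫ ω, (w n (ξ i ω)).toReal ∂P ≤ A := by
    filter_upwards [hwL, hwA] with n hnL hnA i
    rw [integral_toReal (f := fun ω => w n (ξ i ω)) ((hw n).comp (hξ i)).aemeasurable
        (ae_of_all _ fun ω => (hnL _).trans_lt ENNReal.ofReal_lt_top),
      (hlaw i).lintegral_comp (hw n).aemeasurable]
    exact ENNReal.toReal_le_of_le_ofReal hA.le hnA
  have hsum := ae_eventually_sum_le_of_le_rpow (P := P) (Y := fun n i ω => (w n (ξ i ω)).toReal)
    (fun n i => (hw n).ennreal_toReal.comp (hξ i))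
    (fun n => hindep.comp _ fun _ => (hw n).ennreal_toReal) hL hθ hA
    (hwL.mono fun n hn i => ae_of_all _ fun ω =>
      ⟨ENNReal.toReal_nonneg, ENNReal.toReal_le_of_le_ofReal (by positivity) (hn _)⟩)
    hmean
  filter_upwards [hsum] with ω hω
  filter_upwards [hω, hwL, eventually_ge_atTop 1] with n hn hnL hn1
  have hn0 : (0 : ℝ) < n := by exact_mod_cast hn1
  have hreal : ∀ y, ENNReal.ofReal (w n y).toReal = w n y := fun y =>
    ENNReal.ofReal_toReal ((hnL y).trans_lt ENNReal.ofReal_lt_top).ne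
  rw [Finset.sum_range] at hn
  rw [← lintegral_congr hreal,
    lintegral_empiricalMeasure_ofReal _ (hw n).ennreal_toReal fun _ => ENNReal.toReal_nonneg]
  refine ENNReal.ofReal_le_ofReal ((div_le_iff₀ hn0).2 (hn.trans_eq ?_))
  ring

end Empirical

section UniformSample

theorem restrict_Ioo_map_one_sub :
    (volume.restrict (Ioo (0 : ℝ) 1)).map (1 - ·) = volume.restrict (Ioo (0 : ℝ) 1) := by
  have h := (Measure.measurePreserving_sub_left volume (1 : ℝ)).restrict_preimage
    (measurableSet_Ioo (a := (0 : ℝ)) (b := 1))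
  simpa using h.map_eq

variable {Ω : Type*} [MeasurableSpace Ω] {P : Measure Ω} [IsProbabilityMeasure P]
  {ξ : ℕ → Ω → ℝ} {η : ℝ}

theorem measureReal_empiricalMeasure_Iio_le (hξ : ∀ i, Measurable (ξ i)) (hindep : iIndepFun ξ P)
    (hlaw : ∀ i, HasLaw (ξ i) (volume.restrict (Ioo (0 : ℝ) 1)) P) {t : ℝ}
    (ht : t ∈ Icc (0 : ℝ) 1) {n : ℕ} (hn : 1 ≤ n) :
    P.real {ω | (empiricalMeasure fun i : Fin n => ξ i ω).real (Iio t) ≤ t / 2} ≤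
      Real.exp (-(n * t / 10)) := by
  have hind : Measurable ((Iio t).indicator (1 : ℝ → ℝ)) :=
    measurable_one.indicator measurableSet_Iio
  have hmean : ∀ i, ∫ ω, (Iio t).indicator (1 : ℝ → ℝ) (ξ i ω) ∂P = t := by
    intro i
    rw [show ∫ ω, (Iio t).indicator (1 : ℝ → ℝ) (ξ i ω) ∂P = _ from
      (hlaw i).integral_comp hind.aestronglyMeasurable, integral_indicator_one measurableSet_Iio,
      measureReal_congr Iio_ae_eq_Iic, measureReal_def, volume_restrict_Ioo_Iic ht,
      ENNReal.toReal_ofReal ht.1]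
  have hchernoff := measureReal_sum_le_half_le (P := P)
    (Y := fun i ω => (Iio t).indicator (1 : ℝ → ℝ) (ξ i ω)) (m := n * t)
    (fun i => hind.comp (hξ i)) (hindep.comp _ fun _ => hind)
    (fun i => ae_of_all _ fun ω => by by_cases h : ξ i ω ∈ Iio t <;> simp [h])
    (Finset.range n) (mul_nonneg n.cast_nonneg ht.1) (by simp [hmean])
  refine le_of_eq_of_le (congrArg P.real (Set.ext fun ω => ?_)) hchernoff
  rw [mem_ofPred_eq, empiricalMeasure_real_apply _ measurableSet_Iio,
    div_le_iff₀ (by exact_mod_cast hn : (0 : ℝ) < n), mem_ofPred_eq, Finset.sum_range,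
    mul_comm, mul_div_assoc]

-- The grid `(j / n) ^ (1 / (1 + η))` is coarse enough for the Chernoff bounds to be summable, and
-- consecutive values of `t ^ (1 + η)` on it differ by `1 / n`.
theorem ae_eventually_empiricalMeasure_Iio_grid (hξ : ∀ i, Measurable (ξ i))
    (hindep : iIndepFun ξ P) (hlaw : ∀ i, HasLaw (ξ i) (volume.restrict (Ioo (0 : ℝ) 1)) P)
    (hη : 0 < η) :
    ∀ᵐ ω ∂P, ∀ᶠ n : ℕ in atTop, ∀ j ∈ Finset.Icc 1 n,
      ((j : ℝ) / n) ^ (1 / (1 + η)) / 2 <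
        (empiricalMeasure fun i : Fin n => ξ i ω).real (Iio (((j : ℝ) / n) ^ (1 / (1 + η)))) := by
  have hη1 : 0 < 1 + η := by linarith
  have hρ : 0 < 1 - 1 / (1 + η) := sub_pos.2 ((div_lt_one hη1).2 (by linarith))
  set bad : ℕ → ℕ → Set Ω := fun n j =>
    {ω | (empiricalMeasure fun i : Fin n => ξ i ω).real (Iio (((j : ℝ) / n) ^ (1 / (1 + η)))) ≤
      ((j : ℝ) / n) ^ (1 / (1 + η)) / 2}
  have hbad : ∀ n, ∀ j ∈ Finset.Icc 1 n, P.real (bad n j) ≤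
      Real.exp (-(1 / 10) * (n : ℝ) ^ (1 - 1 / (1 + η))) := by
    intro n j hj
    obtain ⟨hj1, hjn⟩ := Finset.mem_Icc.1 hj
    have hn0 : (0 : ℝ) < n := by exact_mod_cast hj1.trans hjn
    have hj1' : (1 : ℝ) ≤ j := by exact_mod_cast hj1
    have hjn' : (j : ℝ) / n ≤ 1 := (div_le_one hn0).2 (by exact_mod_cast hjn)
    refine (measureReal_empiricalMeasure_Iio_le hξ hindep hlaw ⟨by positivity,
      Real.rpow_le_one (by positivity) hjn' (by positivity)⟩ (hj1.trans hjn)).trans ?_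
    have hle : (n : ℝ) ^ (1 - 1 / (1 + η)) ≤ n * ((j : ℝ) / n) ^ (1 / (1 + η)) := by
      rw [Real.rpow_sub hn0, Real.rpow_one, Real.div_rpow (by positivity) hn0.le,
        div_eq_mul_one_div]
      gcongr
      exact Real.one_le_rpow hj1' (by positivity)
    rw [Real.exp_le_exp]
    linarith
  have hunion : ∀ n : ℕ, P.real (⋃ j ∈ Finset.Icc 1 n, bad n j) ≤
      n * Real.exp (-(1 / 10) * (n : ℝ) ^ (1 - 1 / (1 + η))) := fun n =>
    (measureReal_biUnion_finset_le _ _).trans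
      ((Finset.sum_le_card_nsmul _ _ _ (hbad n)).trans_eq (by simp))
  filter_upwards [ae_eventually_notMem_of_measureReal_le
    (summable_mul_exp_neg_mul_rpow (by norm_num) hρ) (Eventually.of_forall hunion)] with ω hω
  filter_upwards [hω] with n hn j hj
  exact not_le.1 fun hmem => hn (mem_biUnion hj hmem)

theorem ae_eventually_rpow_le_empiricalMeasure_Iio (hξ : ∀ i, Measurable (ξ i))
    (hindep : iIndepFun ξ P) (hlaw : ∀ i, HasLaw (ξ i) (volume.restrict (Ioo (0 : ℝ) 1)) P)
    (hη : 0 < η) :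
    ∀ᵐ ω ∂P, ∀ᶠ n : ℕ in atTop, ∀ t ∈ Ioo (0 : ℝ) 1,
      t ^ (1 + η) ≤ 2 * ((empiricalMeasure fun i : Fin n => ξ i ω).real (Iio t) + 1 / n) := by
  have hη1 : 0 < 1 + η := by linarith
  filter_upwards [ae_eventually_empiricalMeasure_Iio_grid hξ hindep hlaw hη] with ω hω
  filter_upwards [hω, eventually_ge_atTop 1] with n hn hn1 t ht
  have hn0 : (0 : ℝ) < n := by exact_mod_cast hn1
  have := isProbabilityMeasure_empiricalMeasure hn1 fun i : Fin n => ξ i ω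
  have htη : 0 ≤ n * t ^ (1 + η) := mul_nonneg hn0.le (Real.rpow_nonneg ht.1.le _)
  set j := ⌊n * t ^ (1 + η)⌋₊
  have hupper : t ^ (1 + η) ≤ (j : ℝ) / n + 1 / n := by
    rw [← add_div, le_div_iff₀' hn0]
    exact (Nat.lt_floor_add_one _).le
  have hjn : (j : ℝ) / n ≤ t ^ (1 + η) := (div_le_iff₀' hn0).2 (Nat.floor_le htη)
  have htη1 : t ^ (1 + η) ≤ 1 := Real.rpow_le_one ht.1.le ht.2.le hη1.le
  suffices hmass : (j : ℝ) / n ≤ 2 * (empiricalMeasure fun i : Fin n => ξ i ω).real (Iio t) by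
    have : (0 : ℝ) ≤ 1 / n := by positivity
    linarith
  rcases Nat.eq_zero_or_pos j with hj0 | hj0
  · rw [hj0, Nat.cast_zero, zero_div]
    positivity
  · have hmem : j ∈ Finset.Icc 1 n := by
      refine Finset.mem_Icc.2 ⟨hj0, ?_⟩
      exact_mod_cast (div_le_one hn0).1 (hjn.trans htη1)
    set τ : ℝ := ((j : ℝ) / n) ^ (1 / (1 + η)) with hτ
    have hτt : τ ≤ t := by
      calc τ ≤ (t ^ (1 + η)) ^ (1 / (1 + η)) := by rw [hτ]; gcongr
        _ = t := by rw [← Real.rpow_mul ht.1.le, mul_one_div_cancel hη1.ne', Real.rpow_one]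
    have hjτ : (j : ℝ) / n ≤ τ := Real.self_le_rpow_of_le_one (by positivity)
      (hjn.trans htη1) ((div_le_one hη1).2 (by linarith))
    have hmono := measureReal_mono (μ := empiricalMeasure fun i : Fin n => ξ i ω)
      (Iio_subset_Iio hτt)
    linarith [hn j hmem]

theorem ae_eventually_hasPowerTails_empiricalMeasure (hξ : ∀ i, Measurable (ξ i))
    (hindep : iIndepFun ξ P) (hlaw : ∀ i, HasLaw (ξ i) (volume.restrict (Ioo (0 : ℝ) 1)) P)
    (hη : 0 < η) :
    ∀ᵐ ω ∂P, ∀ᶠ n : ℕ in atTop,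
      HasPowerTails (empiricalMeasure fun i : Fin n => ξ i ω) η 2 (1 / n) := by
  have hrefl : Measurable fun t : ℝ => 1 - t := by fun_prop
  filter_upwards [ae_eventually_rpow_le_empiricalMeasure_Iio hξ hindep hlaw hη,
    ae_eventually_rpow_le_empiricalMeasure_Iio (ξ := fun i ω => 1 - ξ i ω)
      (fun i => hrefl.comp (hξ i)) (hindep.comp _ fun _ => hrefl)
      (fun i => HasLaw.fun_comp ⟨hrefl.aemeasurable, restrict_Ioo_map_one_sub⟩ (hlaw i)) hη]
    with ω hleft hright
  filter_upwards [hleft, hright, eventually_ge_atTop 1] with n hleft hright hn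
  have := isProbabilityMeasure_empiricalMeasure hn fun i : Fin n => ξ i ω
  refine ⟨fun t ht => (hleft t ht).trans ?_, fun t ht => ?_⟩
  · have hmono := measureReal_mono (μ := empiricalMeasure fun i : Fin n => ξ i ω)
      (Iio_subset_Iic_self (a := t))
    rw [cdf_eq_real]
    gcongr
  · have hmap : (empiricalMeasure fun i : Fin n => 1 - ξ i ω).real (Iio (1 - t)) =
        1 - cdf (empiricalMeasure fun i : Fin n => ξ i ω) t := by
      rw [cdf_eq_real, ← probReal_compl_eq_one_sub measurableSet_Iic, compl_Iic,
        show (fun i : Fin n => 1 - ξ i ω) = (fun t : ℝ => 1 - t) ∘ fun i : Fin n => ξ i ω from rfl,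
        ← map_empiricalMeasure _ hrefl, map_measureReal_apply hrefl measurableSet_Iio]
      congr 1 with s
      simp
    have h := hright (1 - t) ⟨sub_pos.2 ht.2, sub_lt_self _ ht.1⟩
    rwa [hmap] at h

end UniformSample

section Convolution

variable {μ κ : Measure ℝ}

theorem mul_le_conv_of_add_subset [SFinite κ] {A B S : Set ℝ} (hS : MeasurableSet S)
    (h : ∀ x ∈ A, ∀ y ∈ B, x + y ∈ S) : μ A * κ B ≤ (μ ∗ κ) S := by
  rw [Measure.conv, Measure.map_apply measurable_add hS, ← Measure.prod_prod]
  exact measure_mono fun z hz => h z.1 hz.1 z.2 hz.2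

variable [IsProbabilityMeasure μ] [IsProbabilityMeasure κ]

theorem cdf_mul_le_cdf_conv (q t : ℝ) : cdf μ q * κ.real (Iic (t - q)) ≤ cdf (μ ∗ κ) t := by
  rw [cdf_eq_real, cdf_eq_real, measureReal_def, measureReal_def, measureReal_def,
    ← ENNReal.toReal_mul]
  refine ENNReal.toReal_mono (measure_ne_top _ _) (mul_le_conv_of_add_subset measurableSet_Iic ?_)
  exact fun x hx y hy => (add_le_add hx hy).trans_eq (add_sub_cancel q t)

theorem one_sub_cdf_mul_le_one_sub_cdf_conv (q t : ℝ) :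
    (1 - cdf μ q) * κ.real (Ici (t - q)) ≤ 1 - cdf (μ ∗ κ) t := by
  rw [cdf_eq_real, cdf_eq_real, ← probReal_compl_eq_one_sub measurableSet_Iic,
    ← probReal_compl_eq_one_sub measurableSet_Iic, compl_Iic, compl_Iic, measureReal_def,
    measureReal_def, measureReal_def, ← ENNReal.toReal_mul]
  refine ENNReal.toReal_mono (measure_ne_top _ _) (mul_le_conv_of_add_subset measurableSet_Ioi ?_)
  exact fun x hx y hy => (add_sub_cancel q t).symm.trans_lt (add_lt_add_of_lt_of_le hx hy)

theorem HasPowerTails.conv {η C r a : ℝ} (h : HasPowerTails μ η C r) (hC : 0 ≤ C) (hr : 0 ≤ r)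
    (ha : 0 < a) (hleft : a ≤ κ.real (Iic 0)) (hright : a ≤ κ.real (Ici 0)) :
    HasPowerTails (μ ∗ κ) η (C / a) r := by
  have hle : ∀ {s m m' p : ℝ}, s ≤ C * (m + r) → 0 ≤ m → a ≤ p → m * p ≤ m' →
      s ≤ C / a * (m' + r) := by
    intro s m m' p hs hm hp hm'
    refine hs.trans ?_
    rw [div_mul_eq_mul_div, le_div_iff₀ ha, mul_assoc]
    have hmp : m * a ≤ m * p := by gcongr
    have hra : r * a ≤ r :=
      mul_le_of_le_one_right hr (hleft.trans measureReal_le_one)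
    gcongr
    linarith
  refine ⟨fun t ht => hle (h.left t ht) (cdf_nonneg μ t) hleft ?_,
    fun t ht => hle (h.right t ht) (sub_nonneg.2 (cdf_le_one μ t)) hright ?_⟩
  · simpa using cdf_mul_le_cdf_conv (κ := κ) t t
  · simpa using one_sub_cdf_mul_le_one_sub_cdf_conv (κ := κ) t t

theorem tendsto_cdf_conv {μ κ : ℕ → Measure ℝ} (hμ : ∀ᶠ n in atTop, IsProbabilityMeasure (μ n))
    (hκ : ∀ᶠ n in atTop, IsProbabilityMeasure (κ n))
    (hleft : ∀ ε > 0, Tendsto (fun n => (κ n).real (Iic ε)) atTop (𝓝 1))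
    (hright : ∀ ε > 0, Tendsto (fun n => (κ n).real (Ici (-ε))) atTop (𝓝 1))
    (hcdf : ∀ q : ℚ, (q : ℝ) ∈ Ioo (0 : ℝ) 1 → Tendsto (fun n => cdf (μ n) q) atTop (𝓝 q))
    {t : ℝ} (ht : t ∈ Ioo (0 : ℝ) 1) :
    Tendsto (fun n => cdf (μ n ∗ κ n) t) atTop (𝓝 t) := by
  refine tendsto_order.2 ⟨fun a ha => ?_, fun a ha => ?_⟩
  · obtain ⟨q, hq, hqt⟩ := exists_rat_btwn (max_lt ha ht.1)
    obtain ⟨haq, hq0⟩ := max_lt_iff.1 hq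
    have hlim := (hcdf q ⟨hq0, hqt.trans ht.2⟩).mul (hleft (t - q) (sub_pos.2 hqt))
    rw [mul_one] at hlim
    filter_upwards [hμ, hκ, hlim.eventually_const_lt haq] with n _ _ hn
    exact hn.trans_le (cdf_mul_le_cdf_conv _ _)
  · obtain ⟨q, htq, hq⟩ := exists_rat_btwn (lt_min ha ht.2)
    obtain ⟨hqa, hq1⟩ := lt_min_iff.1 hq
    have hlim := ((hcdf q ⟨ht.1.trans htq, hq1⟩).const_sub 1).mul
      (hright (q - t) (sub_pos.2 htq))
    rw [mul_one] at hlim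
    filter_upwards [hμ, hκ, hlim.eventually_const_lt (sub_lt_sub_left hqa 1)] with n _ _ hn
    rw [neg_sub] at hn
    exact (sub_lt_sub_iff_left 1).1 (hn.trans_le (one_sub_cdf_mul_le_one_sub_cdf_conv _ _))

end Convolution

section BoundedDensity

variable {κ : Measure ℝ} {c : ℝ≥0∞} {f : ℝ → ℝ≥0∞} {θ : ℝ}

theorem lintegral_comp_add_left_le (hκ : κ ≤ c • volume) (f : ℝ → ℝ≥0∞) (s : ℝ) :
    ∫⁻ z, f (s + z) ∂κ ≤ c * ∫⁻ z, f z :=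
  calc ∫⁻ z, f (s + z) ∂κ ≤ ∫⁻ z, f (s + z) ∂(c • volume) := lintegral_mono' hκ le_rfl
    _ = c * ∫⁻ z, f z := by
      rw [lintegral_smul_measure, lintegral_add_left_eq_self, smul_eq_mul]

theorem lintegral_conv_le (μ : Measure ℝ) [IsProbabilityMeasure μ] [SFinite κ]
    (hκ : κ ≤ c • volume) (hf : Measurable f) : ∫⁻ s, f s ∂(μ ∗ κ) ≤ c * ∫⁻ s, f s :=
  calc ∫⁻ s, f s ∂(μ ∗ κ) = ∫⁻ s, ∫⁻ z, f (s + z) ∂κ ∂μ := Measure.lintegral_conv hf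
    _ ≤ ∫⁻ _, (c * ∫⁻ z, f z) ∂μ := lintegral_mono fun s => lintegral_comp_add_left_le hκ f s
    _ = c * ∫⁻ s, f s := by simp

variable [IsProbabilityMeasure κ]

theorem lintegral_rpow_comp_add_left_le (hκ : κ ≤ c • volume) (hf : Measurable f) (hθ : 0 < θ)
    (hθ1 : θ ≤ 1) (s : ℝ) : ∫⁻ z, f (s + z) ^ θ ∂κ ≤ (c * ∫⁻ z, f z) ^ θ := by
  have hjensen := eLpNorm'_le_eLpNorm'_of_exponent_le hθ hθ1 κ
    (f := fun z => f (s + z)) (by fun_prop : Measurable _).aestronglyMeasurable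
  simp only [eLpNorm', enorm_eq_self, ENNReal.rpow_one, div_one] at hjensen
  rw [one_div, ENNReal.rpow_inv_le_iff hθ] at hjensen
  exact hjensen.trans (ENNReal.rpow_le_rpow (lintegral_comp_add_left_le hκ f s) hθ.le)

theorem lintegral_lintegral_comp_add (hf : Measurable f) :
    ∫⁻ s, ∫⁻ z, f (s + z) ∂κ = ∫⁻ s, f s := by
  rw [lintegral_lintegral_swap (by fun_prop)]
  simp [lintegral_add_right_eq_self]

end BoundedDensity

section Scaling

variable {ρ : Measure ℝ} {b : ℝ}

theorem measureReal_map_const_mul_Iic (ρ : Measure ℝ) (hb : 0 < b) (t : ℝ) :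
    (ρ.map (b * ·)).real (Iic t) = ρ.real (Iic (t / b)) := by
  rw [map_measureReal_apply (measurable_const_mul b) measurableSet_Iic,
    preimage_const_mul_Iic₀ _ hb]

theorem measureReal_map_const_mul_Ici (ρ : Measure ℝ) (hb : 0 < b) (t : ℝ) :
    (ρ.map (b * ·)).real (Ici t) = ρ.real (Ici (t / b)) := by
  rw [map_measureReal_apply (measurable_const_mul b) measurableSet_Ici,
    preimage_const_mul_Ici₀ _ hb]

theorem map_const_mul_le_smul_volume {c : ℝ≥0∞} (hρ : ρ ≤ c • volume) (hb : 0 < b) :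
    ρ.map (b * ·) ≤ (c * ENNReal.ofReal b⁻¹) • volume :=
  calc ρ.map (b * ·) ≤ (c • volume).map (b * ·) := Measure.map_mono hρ (measurable_const_mul b)
    _ = (c * ENNReal.ofReal b⁻¹) • volume := by
      rw [Measure.map_smul, Real.map_volume_mul_left hb.ne', abs_of_pos (inv_pos.2 hb), smul_smul]

variable [IsProbabilityMeasure ρ] {b : ℕ → ℝ}

theorem tendsto_measureReal_map_const_mul_Iic (hb : Tendsto b atTop (𝓝[>] 0)) {ε : ℝ}
    (hε : 0 < ε) : Tendsto (fun n => (ρ.map (b n * ·)).real (Iic ε)) atTop (𝓝 1) := by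
  have hlim := (tendsto_cdf_atTop ρ).comp (hb.inv_tendsto_nhdsGT_zero.const_mul_atTop hε)
  refine hlim.congr' ?_
  filter_upwards [hb.eventually self_mem_nhdsWithin] with n hn
  rw [measureReal_map_const_mul_Iic ρ hn, ← cdf_eq_real]
  rfl

theorem tendsto_measureReal_map_const_mul_Ici (hb : Tendsto b atTop (𝓝[>] 0)) {ε : ℝ}
    (hε : 0 < ε) : Tendsto (fun n => (ρ.map (b n * ·)).real (Ici (-ε))) atTop (𝓝 1) := by
  have hlim := ((tendsto_cdf_atBot ρ).comp
    (hb.inv_tendsto_nhdsGT_zero.const_mul_atTop_of_neg (neg_neg_of_pos hε))).const_sub 1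
  rw [sub_zero] at hlim
  refine tendsto_of_tendsto_of_tendsto_of_le_of_le' hlim tendsto_const_nhds ?_ ?_
  · filter_upwards [hb.eventually self_mem_nhdsWithin] with n hn
    rw [measureReal_map_const_mul_Ici ρ hn, Function.comp_apply, cdf_eq_real,
      ← probReal_compl_eq_one_sub measurableSet_Iic, compl_Iic]
    exact measureReal_mono Ioi_subset_Ici_self
  · filter_upwards [hb.eventually self_mem_nhdsWithin] with n hn
    rw [measureReal_map_const_mul_Ici ρ hn]
    exact measureReal_le_one

end Scaling

/-- The empirical measure of `x`, smoothed by noise of law `ρ` and scale `b`. Its distribution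
function is the kernel estimator when `ρ` has density `k`. -/
def smoothedMeasure (ρ : Measure ℝ) {n : ℕ} (b : ℝ) (x : Fin n → ℝ) : Measure ℝ :=
  empiricalMeasure x ∗ ρ.map (b * ·)

section Smoothed

variable {ρ : Measure ℝ} [IsProbabilityMeasure ρ]

theorem isProbabilityMeasure_map_const_mul (ρ : Measure ℝ) [IsProbabilityMeasure ρ] (b : ℝ) :
    IsProbabilityMeasure (ρ.map (b * ·)) :=
  Measure.isProbabilityMeasure_map (measurable_const_mul b).aemeasurable

theorem isProbabilityMeasure_smoothedMeasure (ρ : Measure ℝ) [IsProbabilityMeasure ρ] {n : ℕ}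
    (hn : 1 ≤ n) (b : ℝ) (x : Fin n → ℝ) : IsProbabilityMeasure (smoothedMeasure ρ b x) := by
  have := isProbabilityMeasure_empiricalMeasure hn x
  have := isProbabilityMeasure_map_const_mul ρ b
  exact inferInstanceAs (IsProbabilityMeasure (empiricalMeasure x ∗ ρ.map (b * ·)))

theorem cdf_smoothedMeasure {n : ℕ} (hn : 1 ≤ n) {b : ℝ} (hb : 0 < b) (x : Fin n → ℝ) (t : ℝ) :
    cdf (smoothedMeasure ρ b x) t = (∑ i, cdf ρ ((t - x i) / b)) / n := by
  have := isProbabilityMeasure_map_const_mul ρ b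
  have := isProbabilityMeasure_smoothedMeasure ρ hn b x
  have hmass : ∀ s, ∫⁻ z, (Iic t).indicator 1 (s + z) ∂ρ.map (b * ·) =
      ENNReal.ofReal (cdf ρ ((t - s) / b)) := by
    intro s
    rw [cdf_eq_real, ← measureReal_map_const_mul_Iic ρ hb, ofReal_measureReal,
      ← lintegral_indicator_one measurableSet_Iic]
    refine lintegral_congr fun z => indicator_eq_indicator ?_ rfl
    simp only [mem_Iic, le_sub_iff_add_le']
  rw [cdf_eq_real, measureReal_def, ← lintegral_indicator_one measurableSet_Iic, smoothedMeasure,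
    Measure.lintegral_conv (measurable_one.indicator measurableSet_Iic), lintegral_congr hmass,
    lintegral_empiricalMeasure_ofReal x (f := fun s => cdf ρ ((t - s) / b))
      ((monotone_cdf ρ).measurable.comp (by fun_prop)) fun s => cdf_nonneg ρ _,
    ENNReal.toReal_ofReal (div_nonneg (Finset.sum_nonneg fun i _ => cdf_nonneg ρ _) n.cast_nonneg)]

theorem lintegral_smoothedMeasure_lt_top {C : ℝ≥0∞} (hC : C ≠ ∞) (hρ : ρ ≤ C • volume) {n : ℕ}
    (hn : 1 ≤ n) {b : ℝ} (hb : 0 < b) (x : Fin n → ℝ) {f : ℝ → ℝ≥0∞} (hf : Measurable f)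
    (hf_int : ∫⁻ t, f t < ∞) : ∫⁻ t, f t ∂smoothedMeasure ρ b x < ∞ := by
  have := isProbabilityMeasure_empiricalMeasure hn x
  exact (lintegral_conv_le _ (map_const_mul_le_smul_volume hρ hb) hf).trans_lt
    (ENNReal.mul_lt_top (ENNReal.mul_lt_top hC.lt_top ENNReal.ofReal_lt_top) hf_int)

theorem exists_eventually_lintegral_rpow_comp_add_left_le {b : ℕ → ℝ} (hb : ∀ᶠ n in atTop, 0 < b n)
    (hbn : (fun n => (b n)⁻¹) =O[atTop] fun n : ℕ => (n : ℝ)) {C : ℝ≥0∞} (hC : C ≠ ∞)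
    (hρ : ρ ≤ C • volume) {f : ℝ → ℝ≥0∞} (hf : Measurable f) {θ : ℝ} (hθ : θ ∈ Ioo (0 : ℝ) 1)
    (hf_int : ∫⁻ t, f t ≠ ∞) :
    ∃ L > 0, ∀ᶠ n : ℕ in atTop, ∀ s, ∫⁻ z, f (s + z) ^ θ ∂ρ.map (b n * ·) ≤
      ENNReal.ofReal (L * (n : ℝ) ^ θ) := by
  obtain ⟨K, hK, hbK⟩ := hbn.exists_pos
  set L : ℝ := (C.toReal * K * (∫⁻ t, f t).toReal) ^ θ + 1
  have := fun n => isProbabilityMeasure_map_const_mul ρ (b n)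
  refine ⟨L, by positivity, ?_⟩
  filter_upwards [hb, hbK.bound] with n hn hnK s
  rw [Real.norm_of_nonneg (inv_nonneg.2 hn.le), Real.norm_of_nonneg n.cast_nonneg] at hnK
  calc ∫⁻ z, f (s + z) ^ θ ∂ρ.map (b n * ·)
      ≤ (C * ENNReal.ofReal (b n)⁻¹ * ∫⁻ z, f z) ^ θ :=
        lintegral_rpow_comp_add_left_le (map_const_mul_le_smul_volume hρ hn) hf hθ.1 hθ.2.le s
    _ ≤ (C * ENNReal.ofReal (K * n) * ∫⁻ z, f z) ^ θ := by
        gcongr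
        exact hθ.1.le
    _ = ENNReal.ofReal ((C.toReal * K * (∫⁻ t, f t).toReal) ^ θ * (n : ℝ) ^ θ) := by
        rw [← Real.mul_rpow (by positivity) (by positivity),
          ← ENNReal.ofReal_rpow_of_nonneg (by positivity) hθ.1.le]
        nth_rewrite 1 [← ENNReal.ofReal_toReal hC, ← ENNReal.ofReal_toReal hf_int]
        rw [← ENNReal.ofReal_mul (by positivity), ← ENNReal.ofReal_mul (by positivity)]
        congr 2
        ring
    _ ≤ ENNReal.ofReal (L * (n : ℝ) ^ θ) := by
        gcongr
        exact (lt_add_one _).le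

variable {Ω : Type*} [MeasurableSpace Ω] {P : Measure Ω} [IsProbabilityMeasure P]
  {ξ : ℕ → Ω → ℝ} {b : ℕ → ℝ}

-- The noise has density of order `n`, so smoothing caps the integrable function `f ^ θ` at order
-- `n ^ θ`, which is little enough for the Chernoff bound.
theorem ae_eventually_lintegral_rpow_smoothedMeasure_le (hξ : ∀ i, Measurable (ξ i))
    (hindep : iIndepFun ξ P) (hlaw : ∀ i, HasLaw (ξ i) (volume.restrict (Ioo (0 : ℝ) 1)) P)
    (hb : ∀ᶠ n in atTop, 0 < b n) (hbn : (fun n => (b n)⁻¹) =O[atTop] fun n : ℕ => (n : ℝ))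
    {C : ℝ≥0∞} (hC : C ≠ ∞) (hρ : ρ ≤ C • volume) {f : ℝ → ℝ≥0∞} (hf : Measurable f)
    {θ : ℝ} (hθ : θ ∈ Ioo (0 : ℝ) 1) (hf_int : ∫⁻ t, f t ≠ ∞) (hfθ_int : ∫⁻ t, f t ^ θ ≠ ∞) :
    ∃ D : ℝ, ∀ᵐ ω ∂P, ∀ᶠ n in atTop,
      ∫⁻ t, f t ^ θ ∂smoothedMeasure ρ (b n) (fun i : Fin n => ξ i ω) ≤ ENNReal.ofReal D := by
  obtain ⟨L, hL, hcap⟩ :=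
    exists_eventually_lintegral_rpow_comp_add_left_le hb hbn hC hρ hf hθ hf_int
  set A : ℝ := (∫⁻ t, f t ^ θ).toReal + 1
  have hfθ : Measurable fun t => f t ^ θ := hf.pow_const θ
  have := fun n => isProbabilityMeasure_map_const_mul ρ (b n)
  have hmean : ∀ n, ∫⁻ s in Ioo (0 : ℝ) 1, ∫⁻ z, f (s + z) ^ θ ∂ρ.map (b n * ·) ≤
      ENNReal.ofReal A := fun n =>
    calc ∫⁻ s in Ioo (0 : ℝ) 1, ∫⁻ z, f (s + z) ^ θ ∂ρ.map (b n * ·)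
        ≤ ∫⁻ s, ∫⁻ z, f (s + z) ^ θ ∂ρ.map (b n * ·) := setLIntegral_le_lintegral _ _
      _ = ∫⁻ s, f s ^ θ := lintegral_lintegral_comp_add hfθ
      _ ≤ ENNReal.ofReal A := ENNReal.le_ofReal_iff_toReal_le hfθ_int (by positivity) |>.2
          (lt_add_one _).le
  refine ⟨3 * A, ?_⟩
  filter_upwards [ae_eventually_lintegral_empiricalMeasure_le hξ hindep hlaw
    (w := fun n s => ∫⁻ z, f (s + z) ^ θ ∂ρ.map (b n * ·))
    (fun n => (hfθ.comp measurable_add).lintegral_prod_right') hL hθ.2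
    (by positivity) hcap (Eventually.of_forall hmean)] with ω hω
  filter_upwards [hω] with n hn
  rwa [smoothedMeasure, Measure.lintegral_conv hfθ]

end Smoothed

section AlmostSure

variable {Ω : Type*} [MeasurableSpace Ω] {P : Measure Ω} {ξ : ℕ → Ω → ℝ} {g J : ℝ → ℝ}
  {c : ℕ → ℕ → ℝ} {η γ : ℝ}

theorem ae_tendsto_cdf_empiricalMeasure (hindep : iIndepFun ξ P)
    (hlaw : ∀ i, HasLaw (ξ i) (volume.restrict (Ioo (0 : ℝ) 1)) P) :
    ∀ᵐ ω ∂P, ∀ q : ℚ, (q : ℝ) ∈ Ioo (0 : ℝ) 1 →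
      Tendsto (fun n => cdf (empiricalMeasure fun i : Fin n => ξ i ω) q) atTop (𝓝 q) := by
  refine ae_all_iff.2 fun q => ?_
  filter_upwards [ae_tendsto_empiricalMeasure_real hindep hlaw (measurableSet_Iic (a := (q : ℝ)))]
    with ω hω hq
  rw [measureReal_def, volume_restrict_Ioo_Iic ⟨hq.1.le, hq.2.le⟩,
    ENNReal.toReal_ofReal hq.1.le] at hω
  refine hω.congr' ?_
  filter_upwards [eventually_ge_atTop 1] with n hn
  have := isProbabilityMeasure_empiricalMeasure hn fun i : Fin n => ξ i ω
  rw [cdf_eq_real]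

variable {ρ : Measure ℝ} [IsProbabilityMeasure ρ] {b : ℕ → ℝ}

theorem ae_tendsto_cdf_smoothedMeasure (hindep : iIndepFun ξ P)
    (hlaw : ∀ i, HasLaw (ξ i) (volume.restrict (Ioo (0 : ℝ) 1)) P)
    (hb : Tendsto b atTop (𝓝[>] 0)) :
    ∀ᵐ ω ∂P, ∀ t ∈ Ioo (0 : ℝ) 1,
      Tendsto (fun n => cdf (smoothedMeasure ρ (b n) fun i : Fin n => ξ i ω) t) atTop (𝓝 t) := by
  filter_upwards [ae_tendsto_cdf_empiricalMeasure hindep hlaw] with ω hcdf t ht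
  exact tendsto_cdf_conv
    ((eventually_ge_atTop 1).mono fun n hn => isProbabilityMeasure_empiricalMeasure hn _)
    (Eventually.of_forall fun n => isProbabilityMeasure_map_const_mul ρ (b n))
    (fun ε hε => tendsto_measureReal_map_const_mul_Iic hb hε)
    (fun ε hε => tendsto_measureReal_map_const_mul_Ici hb hε) hcdf ht

variable [IsProbabilityMeasure P]

theorem ae_tendsto_integral_quantileIntegrand_empiricalMeasure (hξ : ∀ i, Measurable (ξ i))
    (hindep : iIndepFun ξ P) (hlaw : ∀ i, HasLaw (ξ i) (volume.restrict (Ioo (0 : ℝ) 1)) P)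
    (hdom : IsDominated g c η γ) (hη : 0 < η) (hγ : γ ∈ Ioo (0 : ℝ) 1)
    (hg : Measurable ((Ioo (0 : ℝ) 1).indicator g))
    (hg_cont : ∀ᵐ t ∂volume.restrict (Ioo (0 : ℝ) 1), ContinuousAt g t)
    (hbdd : ∀ t ∈ Ioo (0 : ℝ) 1, ∃ B, ∀ n, 1 ≤ n → |scoreFun c n t| ≤ B)
    (hscore : ∀ᵐ t ∂volume.restrict (Ioo (0 : ℝ) 1),
      g t ≠ 0 → Tendsto (fun n => scoreFun c n t) atTop (𝓝 (J t))) :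
    ∀ᵐ ω ∂P, Tendsto (fun n => ∫ u in Ioo (0 : ℝ) 1,
        quantileIntegrand g c n (empiricalMeasure fun i : Fin n => ξ i ω) u) atTop
      (𝓝 (∫ t in Ioo (0 : ℝ) 1, J t * g t)) := by
  obtain ⟨γ', hγγ', hγ'⟩ := exists_between hγ.2
  have hweight : ∫⁻ t in Ioo (0 : ℝ) 1, endpointWeight γ' t < ∞ :=
    (setLIntegral_le_lintegral _ _).trans_lt (lintegral_endpointWeight_lt_top hγ')
  filter_upwards [ae_tendsto_cdf_empiricalMeasure hindep hlaw,
    ae_eventually_hasPowerTails_empiricalMeasure hξ hindep hlaw hη,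
    ae_tendsto_lintegral_empiricalMeasure hindep hlaw (measurable_endpointWeight γ')
      (endpointWeight_ne_top γ') hweight.ne] with ω hcdf htails hlim
  exact tendsto_integral_quantileIntegrand hdom hγ.1 hγγ' hg hg_cont hbdd hscore
    ((eventually_ge_atTop 1).mono fun n hn => isProbabilityMeasure_empiricalMeasure hn _) hcdf
    two_pos.le htails (ENNReal.add_ne_top.2 ⟨hweight.ne, ENNReal.one_ne_top⟩)
    (hlim.eventually_le_const (ENNReal.lt_add_right hweight.ne one_ne_zero))

theorem ae_eventually_lintegral_endpointWeight_smoothedMeasure_le (hξ : ∀ i, Measurable (ξ i))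
    (hindep : iIndepFun ξ P) (hlaw : ∀ i, HasLaw (ξ i) (volume.restrict (Ioo (0 : ℝ) 1)) P)
    {C : ℝ≥0∞} (hC : C ≠ ∞) (hρ : ρ ≤ C • volume) (hb : ∀ᶠ n in atTop, 0 < b n)
    (hbn : (fun n => (b n)⁻¹) =O[atTop] fun n : ℕ => (n : ℝ)) (hγ : γ ∈ Ioo (0 : ℝ) 1) :
    ∃ D : ℝ, ∀ᵐ ω ∂P, ∀ᶠ n in atTop,
      ∫⁻ t, endpointWeight γ t ∂smoothedMeasure ρ (b n) (fun i : Fin n => ξ i ω) ≤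
        ENNReal.ofReal D := by
  obtain ⟨β, hγβ, hβ⟩ := exists_between hγ.2
  have hβ0 : 0 < β := hγ.1.trans hγβ
  have hθ : γ / β ∈ Ioo (0 : ℝ) 1 := ⟨div_pos hγ.1 hβ0, (div_lt_one hβ0).2 hγβ⟩
  have hpow : ∀ t, endpointWeight β t ^ (γ / β) = endpointWeight γ t := fun t => by
    rw [endpointWeight_rpow hθ.1, mul_div_cancel₀ γ hβ0.ne']
  simpa only [hpow] using ae_eventually_lintegral_rpow_smoothedMeasure_le hξ hindep hlaw hb hbn hC
    hρ (measurable_endpointWeight β) hθ (lintegral_endpointWeight_lt_top hβ).ne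
    (by simpa only [hpow] using (lintegral_endpointWeight_lt_top hγ.2).ne)

theorem ae_eventually_hasPowerTails_smoothedMeasure (hξ : ∀ i, Measurable (ξ i))
    (hindep : iIndepFun ξ P) (hlaw : ∀ i, HasLaw (ξ i) (volume.restrict (Ioo (0 : ℝ) 1)) P)
    (hleft : 0 < ρ (Iic 0)) (hright : 0 < ρ (Ici 0)) (hb : ∀ᶠ n in atTop, 0 < b n) (hη : 0 < η) :
    ∃ C ≥ 0, ∀ᵐ ω ∂P, ∀ᶠ n : ℕ in atTop,
      HasPowerTails (smoothedMeasure ρ (b n) fun i : Fin n => ξ i ω) η C (1 / n) := by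
  set a := min (ρ.real (Iic 0)) (ρ.real (Ici 0))
  have ha : 0 < a := lt_min (ENNReal.toReal_pos hleft.ne' (measure_ne_top _ _))
    (ENNReal.toReal_pos hright.ne' (measure_ne_top _ _))
  refine ⟨2 / a, by positivity, ?_⟩
  filter_upwards [ae_eventually_hasPowerTails_empiricalMeasure hξ hindep hlaw hη] with ω htails
  filter_upwards [htails, hb, eventually_ge_atTop 1] with n htail hbn hn
  have := isProbabilityMeasure_empiricalMeasure hn fun i : Fin n => ξ i ω
  have := isProbabilityMeasure_map_const_mul ρ (b n)
  refine htail.conv two_pos.le (by positivity) ha ?_ ?_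
  · rw [measureReal_map_const_mul_Iic ρ hbn, zero_div]
    exact min_le_left _ _
  · rw [measureReal_map_const_mul_Ici ρ hbn, zero_div]
    exact min_le_right _ _

theorem ae_tendsto_integral_quantileIntegrand_smoothedMeasure (hξ : ∀ i, Measurable (ξ i))
    (hindep : iIndepFun ξ P) (hlaw : ∀ i, HasLaw (ξ i) (volume.restrict (Ioo (0 : ℝ) 1)) P)
    {C : ℝ≥0∞} (hC : C ≠ ∞) (hρ : ρ ≤ C • volume)
    (hleft : 0 < ρ (Iic 0)) (hright : 0 < ρ (Ici 0)) (hb : Tendsto b atTop (𝓝[>] 0))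
    (hbn : (fun n => (b n)⁻¹) =O[atTop] fun n : ℕ => (n : ℝ))
    (hdom : IsDominated g c η γ) (hη : 0 < η) (hγ : γ ∈ Ioo (0 : ℝ) 1)
    (hg : Measurable ((Ioo (0 : ℝ) 1).indicator g))
    (hg_cont : ∀ᵐ t ∂volume.restrict (Ioo (0 : ℝ) 1), ContinuousAt g t)
    (hbdd : ∀ t ∈ Ioo (0 : ℝ) 1, ∃ B, ∀ n, 1 ≤ n → |scoreFun c n t| ≤ B)
    (hscore : ∀ᵐ t ∂volume.restrict (Ioo (0 : ℝ) 1),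
      g t ≠ 0 → Tendsto (fun n => scoreFun c n t) atTop (𝓝 (J t))) :
    ∀ᵐ ω ∂P, Tendsto (fun n => ∫ u in Ioo (0 : ℝ) 1,
        quantileIntegrand g c n (smoothedMeasure ρ (b n) fun i : Fin n => ξ i ω) u) atTop
      (𝓝 (∫ t in Ioo (0 : ℝ) 1, J t * g t)) := by
  obtain ⟨γ', hγγ', hγ'⟩ := exists_between hγ.2
  have hbpos : ∀ᶠ n in atTop, 0 < b n := hb.eventually self_mem_nhdsWithin
  obtain ⟨D, hD⟩ := ae_eventually_lintegral_endpointWeight_smoothedMeasure_le hξ hindep hlaw hC hρ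
    hbpos hbn ⟨hγ.1.trans hγγ', hγ'⟩
  obtain ⟨A, hA, htails⟩ := ae_eventually_hasPowerTails_smoothedMeasure hξ hindep hlaw hleft hright
    hbpos hη
  filter_upwards [ae_tendsto_cdf_smoothedMeasure (ρ := ρ) hindep hlaw hb, htails, hD]
    with ω hcdf htails hweight
  exact tendsto_integral_quantileIntegrand hdom hγ.1 hγγ' hg hg_cont hbdd hscore
    ((eventually_ge_atTop 1).mono fun n hn => isProbabilityMeasure_smoothedMeasure ρ hn _ _)
    (fun q hq => hcdf q hq) hA htails ENNReal.ofReal_ne_top hweight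

end AlmostSure

section OrderStatistics

variable {n : ℕ}

theorem orderStat_le_iff (x : Fin n → ℝ) (j : Fin n) (t : ℝ) :
    orderStat x j ≤ t ↔ (j : ℕ) < Finset.card {i | x i ≤ t} := by
  rw [← Finset.card_map (Tuple.sort x).symm.toEmbedding]
  refine (Tuple.lt_card_le_iff_apply_le_of_monotone (Tuple.monotone_sort x)).symm.trans ?_
  congr! 2
  ext i
  simp

theorem cdf_empiricalMeasure (hn : 1 ≤ n) (x : Fin n → ℝ) (t : ℝ) :
    cdf (empiricalMeasure x) t = (Finset.card {i | x i ≤ t} : ℝ) / n := by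
  have := isProbabilityMeasure_empiricalMeasure hn x
  rw [cdf_eq_real, empiricalMeasure_real_apply x measurableSet_Iic]
  simp only [indicator_apply, mem_Iic, Pi.one_apply, Finset.sum_boole]

theorem leftInverse_cdf_empiricalMeasure (x : Fin n → ℝ) (j : Fin n) {u : ℝ}
    (hu : u ∈ Ioo (0 : ℝ) 1) (hju : u ∈ Ioc ((j : ℝ) / n) ((j + 1) / n)) :
    leftInverse (cdf (empiricalMeasure x)) u = orderStat x j := by
  have hn : 1 ≤ n := Nat.one_le_of_lt j.2
  have hn0 : (0 : ℝ) < n := by exact_mod_cast hn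
  rw [mem_Ioc, div_lt_iff₀ hn0, le_div_iff₀ hn0] at hju
  refine eq_of_forall_ge_iff fun t => ?_
  rw [leftInverse_cdf_le_iff _ hu, orderStat_le_iff, cdf_empiricalMeasure hn, le_div_iff₀ hn0]
  refine ⟨fun h => ?_, fun h => hju.2.trans ?_⟩
  · exact_mod_cast hju.1.trans_le h
  · exact_mod_cast h

theorem setIntegral_Ioo_eq_sum_div (hn : 1 ≤ n) {f : ℝ → ℝ} {a : Fin n → ℝ}
    (h : ∀ j : Fin n, ∀ u ∈ Ioo ((j : ℝ) / n) ((j + 1) / n), f u = a j) :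
    ∫ u in Ioo (0 : ℝ) 1, f u = (∑ j, a j) / n := by
  have hn0 : (0 : ℝ) < n := by exact_mod_cast hn
  have hle : ∀ j : ℕ, (j : ℝ) / n ≤ ((j + 1 : ℕ) : ℝ) / n := fun j => by gcongr; omega
  have hcell : ∀ j : Fin n,
      EqOn (fun _ => a j) f (Ioo ((j : ℝ) / n) (((j + 1 : ℕ) : ℝ) / n)) := fun j u hu =>
    (h j u (by simpa only [Nat.cast_add_one] using hu)).symm
  have hint : ∀ j < n, IntervalIntegrable f volume ((j : ℝ) / n) (((j + 1 : ℕ) : ℝ) / n) := by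
    intro j hj
    rw [intervalIntegrable_iff_integrableOn_Ioo_of_le (hle j)]
    exact (integrableOn_const (by simp)).congr_fun (hcell ⟨j, hj⟩) measurableSet_Ioo
  have hval : ∀ j : Fin n, ∫ u in (j : ℝ) / n..((j + 1 : ℕ) : ℝ) / n, f u = a j / n := by
    intro j
    rw [intervalIntegral.integral_of_le (hle j), integral_Ioc_eq_integral_Ioo,
      ← setIntegral_congr_fun measurableSet_Ioo (hcell j), setIntegral_const,
      Real.volume_real_Ioo_of_le (hle j), smul_eq_mul]
    push_cast
    ring
  have hsum := intervalIntegral.sum_integral_adjacent_intervals (a := fun j : ℕ => (j : ℝ) / n) hint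
  rw [← Fin.sum_univ_eq_sum_range fun j : ℕ => ∫ u in (j : ℝ) / n..((j + 1 : ℕ) : ℝ) / n, f u,
    Finset.sum_congr rfl fun j _ => hval j, ← Finset.sum_div] at hsum
  rw [hsum, Nat.cast_zero, zero_div, div_self hn0.ne', intervalIntegral.integral_of_le zero_le_one,
    integral_Ioc_eq_integral_Ioo]

theorem scoreFun_of_mem_Ioc (c : ℕ → ℕ → ℝ) {j : ℕ} {u : ℝ} (hn : 1 ≤ n)
    (hu : u ∈ Ioc ((j : ℝ) / n) ((j + 1) / n)) : scoreFun c n u = c n (j + 1) := by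
  have hn0 : (0 : ℝ) < n := by exact_mod_cast hn
  rw [mem_Ioc, div_lt_iff₀ hn0, le_div_iff₀ hn0, mul_comm] at hu
  have hceil : ⌈(n : ℝ) * u⌉₊ = j + 1 := by
    rw [Nat.ceil_eq_iff (by omega)]
    exact_mod_cast hu
  rw [scoreFun, hceil, max_eq_right (by omega)]

theorem integral_quantileIntegrand_empiricalMeasure (g : ℝ → ℝ) (c : ℕ → ℕ → ℝ) (hn : 1 ≤ n)
    {x : Fin n → ℝ} (hx : ∀ i, x i ∈ Ioo (0 : ℝ) 1) :
    ∫ u in Ioo (0 : ℝ) 1, quantileIntegrand g c n (empiricalMeasure x) u = lStatistic g c x := by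
  have hn0 : (0 : ℝ) < n := by exact_mod_cast hn
  rw [lStatistic, one_div_mul_eq_div]
  refine setIntegral_Ioo_eq_sum_div hn fun j u hu => ?_
  have hu01 : u ∈ Ioo (0 : ℝ) 1 := by
    refine ⟨lt_of_le_of_lt (by positivity) hu.1, hu.2.trans_le ((div_le_one hn0).2 ?_)⟩
    exact_mod_cast j.2
  rw [quantileIntegrand, leftInverse_cdf_empiricalMeasure x j hu01 (Ioo_subset_Ioc_self hu),
    scoreFun_of_mem_Ioc c hn (Ioo_subset_Ioc_self hu), indicator_of_mem]
  exact hx _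

end OrderStatistics

section Kernel

/-- The measure with density `k`, whose distribution function is `kernelCDF k`. -/
def kernelMeasure (k : ℝ → ℝ) : Measure ℝ := volume.withDensity fun x => ENNReal.ofReal (k x)

variable {k : ℝ → ℝ}

theorem kernelMeasure_real_apply (hk : Integrable k) (hk0 : ∀ x, 0 ≤ k x) {S : Set ℝ}
    (hS : MeasurableSet S) : (kernelMeasure k).real S = ∫ x in S, k x := by
  rw [measureReal_def, kernelMeasure, withDensity_apply _ hS,
    ← ofReal_integral_eq_lintegral_ofReal hk.integrableOn (Eventually.of_forall hk0),
    ENNReal.toReal_ofReal (integral_nonneg hk0)]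

theorem isProbabilityMeasure_kernelMeasure (hk : Integrable k) (hk0 : ∀ x, 0 ≤ k x)
    (hk1 : ∫ x, k x = 1) : IsProbabilityMeasure (kernelMeasure k) := by
  refine isProbabilityMeasure_iff_real.2 ?_
  rw [kernelMeasure_real_apply hk hk0 .univ, setIntegral_univ, hk1]

theorem cdf_kernelMeasure [IsProbabilityMeasure (kernelMeasure k)] (hk : Integrable k)
    (hk0 : ∀ x, 0 ≤ k x) : ⇑(cdf (kernelMeasure k)) = kernelCDF k :=
  funext fun _ => (cdf_eq_real _ _).trans (kernelMeasure_real_apply hk hk0 measurableSet_Iic)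

theorem kernelMeasure_le_smul_volume {C : ℝ} (hkC : ∀ x, k x ≤ C) :
    kernelMeasure k ≤ ENNReal.ofReal C • volume := by
  rw [← withDensity_const]
  exact withDensity_mono (Eventually.of_forall fun x => ENNReal.ofReal_le_ofReal (hkC x))

theorem kernelMeasure_Iic_pos_iff [IsProbabilityMeasure (kernelMeasure k)] (hk : Integrable k)
    (hk0 : ∀ x, 0 ≤ k x) {t : ℝ} : 0 < kernelMeasure k (Iic t) ↔ 0 < kernelCDF k t := by
  rw [kernelCDF, ← kernelMeasure_real_apply hk hk0 measurableSet_Iic, measureReal_def,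
    ENNReal.toReal_pos_iff, and_iff_left (measure_lt_top _ _)]

theorem kernelMeasure_Ici_pos_iff [IsProbabilityMeasure (kernelMeasure k)] (hk : Integrable k)
    (hk0 : ∀ x, 0 ≤ k x) {t : ℝ} : 0 < kernelMeasure k (Ici t) ↔ kernelCDF k t < 1 := by
  have hIci : kernelMeasure k (Ici t) = kernelMeasure k (Ioi t) :=
    measure_congr ((withDensity_absolutelyContinuous _ _).ae_le Ioi_ae_eq_Ici.symm)
  have hsub : 1 - kernelCDF k t = (kernelMeasure k).real (Ioi t) := by
    rw [kernelCDF, ← kernelMeasure_real_apply hk hk0 measurableSet_Iic,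
      ← probReal_compl_eq_one_sub measurableSet_Iic, compl_Iic]
  rw [hIci, ← sub_pos (a := 1), hsub, measureReal_def, ENNReal.toReal_pos_iff,
    and_iff_left (measure_lt_top _ _)]

theorem setIntegral_Iic_comp_sub_div (k : ℝ → ℝ) {b : ℝ} (hb : 0 < b) (x t : ℝ) :
    ∫ y in Iic t, k ((y - x) / b) = b * kernelCDF k ((t - x) / b) := by
  have hpre : ∀ y, (Iic t).indicator (fun y => k ((y - x) / b)) y =
      (Iic ((t - x) / b)).indicator k ((y - x) / b) := fun y =>
    indicator_eq_indicator
      (by rw [mem_Iic, mem_Iic, div_le_div_iff_of_pos_right hb, sub_le_sub_iff_right]) rfl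
  rw [← integral_indicator measurableSet_Iic, integral_congr_ae (Eventually.of_forall hpre),
    integral_sub_right_eq_self (fun y => (Iic ((t - x) / b)).indicator k (y / b)) x,
    Measure.integral_comp_div, integral_indicator measurableSet_Iic, abs_of_pos hb, smul_eq_mul,
    kernelCDF]

theorem kernelEstimator_eq_cdf [IsProbabilityMeasure (kernelMeasure k)] (hk : Integrable k)
    (hk0 : ∀ x, 0 ≤ k x) {n : ℕ} (hn : 1 ≤ n) {b : ℝ} (hb : 0 < b) (x : Fin n → ℝ) :
    kernelEstimator k b x = cdf (smoothedMeasure (kernelMeasure k) b x) := by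
  funext t
  rw [cdf_smoothedMeasure hn hb, cdf_kernelMeasure hk hk0, kernelEstimator,
    Finset.sum_congr rfl fun i _ => setIntegral_Iic_comp_sub_div k hb (x i) t, ← Finset.mul_sum]
  field_simp

theorem kernelIntegrand_eq_quantileIntegrand [IsProbabilityMeasure (kernelMeasure k)]
    (hk : Integrable k) (hk0 : ∀ x, 0 ≤ k x) (g : ℝ → ℝ) (c : ℕ → ℕ → ℝ) {n : ℕ} (hn : 1 ≤ n)
    {b : ℝ} (hb : 0 < b) (x : Fin n → ℝ) :
    kernelIntegrand k g c b x =
      quantileIntegrand g c n (smoothedMeasure (kernelMeasure k) b x) := by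
  funext u
  rw [kernelIntegrand, quantileIntegrand, kernelEstimator_eq_cdf hk hk0 hn hb]

theorem kernelStatistic_eq_integral_quantileIntegrand [IsProbabilityMeasure (kernelMeasure k)]
    (hk : Integrable k) (hk0 : ∀ x, 0 ≤ k x) (g : ℝ → ℝ) (c : ℕ → ℕ → ℝ) {n : ℕ} (hn : 1 ≤ n)
    {b : ℝ} (hb : 0 < b) (x : Fin n → ℝ) :
    kernelStatistic k g c b x =
      ∫ u in Ioo (0 : ℝ) 1, quantileIntegrand g c n (smoothedMeasure (kernelMeasure k) b x) u := by
  rw [kernelStatistic, kernelIntegrand_eq_quantileIntegrand hk hk0 g c hn hb]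

end Kernel

namespace IsKernelDensity

variable {k : ℝ → ℝ}

theorem isProbabilityMeasure (hk : IsKernelDensity k) : IsProbabilityMeasure (kernelMeasure k) :=
  isProbabilityMeasure_kernelMeasure hk.integrable hk.nonneg hk.integral_eq_one

theorem integrable_mul_id (hk : IsKernelDensity k) : Integrable fun x => x * k x := by
  refine (hk.integrable.add hk.integrable_sq).mono'
    (aestronglyMeasurable_id.mul hk.integrable.aestronglyMeasurable)
    (Eventually.of_forall fun x => ?_)
  have hx : |x| ≤ 1 + x ^ 2 := by
    rw [← sq_abs]
    nlinarith [sq_nonneg (|x| - 1), abs_nonneg x]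
  calc ‖x * k x‖ = |x| * k x := by rw [Real.norm_eq_abs, abs_mul, abs_of_nonneg (hk.nonneg x)]
    _ ≤ (1 + x ^ 2) * k x := mul_le_mul_of_nonneg_right hx (hk.nonneg x)
    _ = k x + x ^ 2 * k x := by ring

theorem integrable_id_kernelMeasure (hk : IsKernelDensity k) : Integrable id (kernelMeasure k) := by
  refine (integrable_withDensity_iff_integrable_smul₀'
    hk.integrable.aestronglyMeasurable.aemeasurable.ennreal_ofReal
    (Eventually.of_forall fun x => ENNReal.ofReal_lt_top)).2 ?_
  simpa only [ENNReal.toReal_ofReal (hk.nonneg _), smul_eq_mul, id, mul_comm]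
    using hk.integrable_mul_id

theorem integral_id_kernelMeasure (hk : IsKernelDensity k) : ∫ x, id x ∂kernelMeasure k = 0 := by
  rw [kernelMeasure, integral_withDensity_eq_integral_toReal_smul₀
    hk.integrable.aestronglyMeasurable.aemeasurable.ennreal_ofReal
    (Eventually.of_forall fun x => ENNReal.ofReal_lt_top)]
  simpa only [ENNReal.toReal_ofReal (hk.nonneg _), smul_eq_mul, id, mul_comm] using hk.mean_zero

theorem kernelCDF_zero_pos (hk : IsKernelDensity k) : 0 < kernelCDF k 0 := by
  have := hk.isProbabilityMeasure
  have hpos := measure_le_integral_pos hk.integrable_id_kernelMeasure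
  rw [hk.integral_id_kernelMeasure] at hpos
  exact (kernelMeasure_Iic_pos_iff hk.integrable hk.nonneg).1 hpos

theorem kernelCDF_zero_lt_one (hk : IsKernelDensity k) : kernelCDF k 0 < 1 := by
  have := hk.isProbabilityMeasure
  have hpos := measure_integral_le_pos hk.integrable_id_kernelMeasure
  rw [hk.integral_id_kernelMeasure] at hpos
  exact (kernelMeasure_Ici_pos_iff hk.integrable hk.nonneg).1 hpos

end IsKernelDensity

theorem IsBandwidth.inv_isBigO {b : ℕ → ℝ} (hb : IsBandwidth b) :
    (fun n => (b n)⁻¹) =O[atTop] fun n : ℕ => (n : ℝ) := by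
  refine Asymptotics.IsBigO.of_bound 1 ?_
  filter_upwards [hb.tendsto_mul_atTop.eventually_ge_atTop 1, eventually_ge_atTop 1] with n hn hn1
  have hbn := hb.pos n hn1
  rw [one_mul, Real.norm_of_nonneg (inv_nonneg.2 hbn.le), Real.norm_of_nonneg n.cast_nonneg,
    inv_le_iff_one_le_mul₀ hbn]
  exact hn

theorem measurable_indicator_of_monotoneOn {S : Set ℝ} (hS : MeasurableSet S) {p : ℝ → ℝ}
    (hp : MonotoneOn p S) : Measurable (S.indicator p) := by
  refine measurable_of_restrict_of_restrict_compl hS ?_ ?_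
  · have hrestrict : S.domRestrict (S.indicator p) = fun s : S => p s :=
      domRestrict_eq_iff.2 fun s hs => indicator_of_mem hs p
    rw [hrestrict]
    exact Monotone.measurable fun s t hst => hp s.2 t.2 hst
  · have hrestrict : Sᶜ.domRestrict (S.indicator p) = fun _ => 0 :=
      domRestrict_eq_iff.2 fun s hs => indicator_of_notMem hs p
    rw [hrestrict]
    exact measurable_const

namespace IsClassG

variable {g : ℝ → ℝ}

theorem measurable_indicator (hg : IsClassG g) : Measurable ((Ioo (0 : ℝ) 1).indicator g) := by
  obtain ⟨p, q, hp, hq, rfl⟩ := hg.locallyBoundedVariationOn.exists_monotoneOn_sub_monotoneOn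
  rw [indicator_sub']
  exact (measurable_indicator_of_monotoneOn measurableSet_Ioo hp).sub
    (measurable_indicator_of_monotoneOn measurableSet_Ioo hq)

theorem ae_continuousAt (hg : IsClassG g) :
    ∀ᵐ t ∂volume.restrict (Ioo (0 : ℝ) 1), ContinuousAt g t := by
  rw [ae_restrict_iff' measurableSet_Ioo]
  filter_upwards [hg.locallyBoundedVariationOn.ae_differentiableWithinAt_of_mem] with t ht hmem
  exact (ht hmem).continuousWithinAt.continuousAt (Ioo_mem_nhds hmem.1 hmem.2)

end IsClassG

theorem hasLaw_of_isUniform {Ω : Type*} [MeasurableSpace Ω] {P : Measure Ω} {X : Ω → ℝ}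
    (hXm : AEMeasurable X P) (hX : pdf.IsUniform X (Ioo (0 : ℝ) 1) P volume) :
    HasLaw X (volume.restrict (Ioo (0 : ℝ) 1)) P :=
  ⟨hXm, hX.trans (by simp [ProbabilityTheory.cond])⟩

theorem ae_forall_mem_of_hasLaw_restrict {Ω ι : Type*} [MeasurableSpace Ω] [Countable ι]
    {P : Measure Ω} {X : ι → Ω → ℝ} {S : Set ℝ} (hS : MeasurableSet S)
    (hX : ∀ i, HasLaw (X i) (volume.restrict S) P) : ∀ᵐ ω ∂P, ∀ i, X i ω ∈ S :=
  ae_all_iff.2 fun i => ((hX i).ae_iff hS.mem).2 (ae_restrict_mem hS)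

end KernelLStat

theorem theorem4_general {Ω : Type*} [MeasurableSpace Ω] {P : Measure Ω} [IsProbabilityMeasure P]
    {ξ : ℕ → Ω → ℝ} (hξ : ∀ i, Measurable (ξ i)) (hindep : iIndepFun ξ P)
    (hlaw : ∀ i, HasLaw (ξ i) (volume.restrict (Ioo (0 : ℝ) 1)) P)
    {k : ℝ → ℝ} (hk : Integrable k) (hk0 : ∀ x, 0 ≤ k x) (hk1 : ∫ x, k x = 1)
    (hkC : ∃ C : ℝ, ∀ x, k x ≤ C) (hleft : 0 < kernelCDF k 0) (hright : kernelCDF k 0 < 1)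
    {b : ℕ → ℝ} (hb : ∀ n, 1 ≤ n → 0 < b n) (hb0 : Tendsto b atTop (𝓝 0))
    (hbn : (fun n => (b n)⁻¹) =O[atTop] fun n : ℕ => (n : ℝ))
    {g J : ℝ → ℝ} (hg : Measurable ((Ioo (0 : ℝ) 1).indicator g))
    (hg_cont : ∀ᵐ t ∂volume.restrict (Ioo (0 : ℝ) 1), ContinuousAt g t)
    {c : ℕ → ℕ → ℝ} {M b₁ b₂ δ : ℝ} (hb₁ : 0 ≤ b₁) (hb₂ : 0 ≤ b₂) (hδ : 0 < δ)
    (hgD : ∀ t ∈ Ioo (0 : ℝ) 1, |g t| ≤ boundD M b₁ b₂ δ t)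
    (hcB : ∀ n, 1 ≤ n → ∀ t ∈ Ioo (0 : ℝ) 1, |scoreFun c n t| ≤ boundB M b₁ b₂ t)
    (hscore : ∀ᵐ t ∂volume.restrict (Ioo (0 : ℝ) 1),
      g t ≠ 0 → Tendsto (fun n => scoreFun c n t) atTop (𝓝 (J t))) :
    IntegrableOn (fun t => J t * g t) (Ioo (0 : ℝ) 1) ∧
    (∀ᵐ ω ∂P, ∀ n, 1 ≤ n → IntegrableOn
      (kernelIntegrand k g c (b n) fun i : Fin n => ξ i ω) (Ioo (0 : ℝ) 1)) ∧
    (∀ᵐ ω ∂P, Tendsto (fun n => kernelStatistic k g c (b n) fun i : Fin n => ξ i ω) atTop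
      (𝓝 (∫ t in Ioo (0 : ℝ) 1, J t * g t))) ∧
    (∀ᵐ ω ∂P, Tendsto (fun n => lStatistic g c fun i : Fin n => ξ i ω) atTop
      (𝓝 (∫ t in Ioo (0 : ℝ) 1, J t * g t))) := by
  obtain ⟨C, hkC⟩ := hkC
  obtain ⟨η, hη, γ, hγ, hdom⟩ := exists_isDominated hb₁ hb₂ hδ hgD hcB
  have := isProbabilityMeasure_kernelMeasure hk hk0 hk1
  have hρ := kernelMeasure_le_smul_volume hkC
  have hbdd : ∀ t ∈ Ioo (0 : ℝ) 1, ∃ B, ∀ n, 1 ≤ n → |scoreFun c n t| ≤ B :=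
    fun t ht => ⟨_, fun n hn => hcB n hn t ht⟩
  refine ⟨integrableOn_mul_of_tendsto_scoreFun hdom hη.le hγ.2 hg hscore,
    Eventually.of_forall fun ω n hn => ?_, ?_, ?_⟩
  · rw [kernelIntegrand_eq_quantileIntegrand hk hk0 g c hn (hb n hn)]
    have := isProbabilityMeasure_smoothedMeasure (kernelMeasure k) hn (b n) fun i : Fin n => ξ i ω
    exact integrableOn_quantileIntegrand hdom hη.le hg hn (lintegral_smoothedMeasure_lt_top
      ENNReal.ofReal_ne_top hρ hn (hb n hn) _ (measurable_endpointWeight γ)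
      (lintegral_endpointWeight_lt_top hγ.2))
  · filter_upwards [ae_tendsto_integral_quantileIntegrand_smoothedMeasure hξ hindep hlaw
      ENNReal.ofReal_ne_top hρ ((kernelMeasure_Iic_pos_iff hk hk0).2 hleft)
      ((kernelMeasure_Ici_pos_iff hk hk0).2 hright) (tendsto_nhdsWithin_iff.2
      ⟨hb0, (eventually_ge_atTop 1).mono hb⟩) hbn hdom hη hγ hg hg_cont hbdd hscore] with ω hω
    refine hω.congr' ((eventually_ge_atTop 1).mono fun n hn => ?_)
    exact (kernelStatistic_eq_integral_quantileIntegrand hk hk0 g c hn (hb n hn) _).symm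
  · filter_upwards [ae_tendsto_integral_quantileIntegrand_empiricalMeasure hξ hindep hlaw hdom hη
      hγ hg hg_cont hbdd hscore,
      ae_forall_mem_of_hasLaw_restrict measurableSet_Ioo hlaw] with ω hω hmem
    exact hω.congr' ((eventually_ge_atTop 1).mono fun n hn =>
      integral_quantileIntegrand_empiricalMeasure g c hn fun i => hmem i)

theorem theorem4 {Ω : Type*} [MeasurableSpace Ω] (P : Measure Ω) [IsProbabilityMeasure P]
    (ξ : ℕ → Ω → ℝ) (hξ_meas : ∀ i, Measurable (ξ i)) (hξ_indep : iIndepFun ξ P)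
    (hξ_unif : ∀ i, pdf.IsUniform (ξ i) (Set.Ioo (0 : ℝ) 1) P volume)
    (k : ℝ → ℝ) (hk : IsKernelDensity k)
    (b : ℕ → ℝ) (hb : IsBandwidth b)
    (g : ℝ → ℝ) (hg : IsClassG g)
    (J : ℝ → ℝ) (hJ : Measurable fun t : Set.Ioo (0 : ℝ) 1 => J t)
    (c : ℕ → ℕ → ℝ)
    (M b₁ b₂ δ : ℝ) (hM : 0 < M) (hb₁ : 0 < b₁) (hb₂ : 0 < b₂) (hδ : 0 < δ)
    (hbound : BoundednessCondition g J hg c M b₁ b₂ δ)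
    (hsmooth : SmoothnessCondition g J hg c) :
    IntegrableOn (fun t => J t * g t) (Set.Ioo (0 : ℝ) 1) ∧
    (∀ᵐ ω ∂P, ∀ n, 1 ≤ n → IntegrableOn
      (kernelIntegrand k g c (b n) fun i : Fin n => ξ i ω) (Set.Ioo (0 : ℝ) 1)) ∧
    (∀ᵐ ω ∂P, Tendsto (fun n => kernelStatistic k g c (b n) fun i : Fin n => ξ i ω) atTop
      (𝓝 (∫ t in Set.Ioo (0 : ℝ) 1, J t * g t))) ∧
    (∀ᵐ ω ∂P, Tendsto (fun n => lStatistic g c fun i : Fin n => ξ i ω) atTop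
      (𝓝 (∫ t in Set.Ioo (0 : ℝ) 1, J t * g t))) := by
  exact theorem4_general hξ_meas hξ_indep
    (fun i => hasLaw_of_isUniform (hξ_meas i).aemeasurable (hξ_unif i)) hk.integrable hk.nonneg
    hk.integral_eq_one hk.bounded hk.kernelCDF_zero_pos hk.kernelCDF_zero_lt_one hb.pos
    hb.tendsto_zero hb.inv_isBigO hg.measurable_indicator hg.ae_continuousAt hb₁.le hb₂.le hδ
    hbound.abs_g_le hbound.abs_score_le hsmooth.ae_volume

end
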